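/- Let $S_1=\mathbb R/\mathbb Z=[0,1)$. A \emph{subshift} over $K\subset\mathbb C$ is a closed subset $X\subset K^{\mathbb N}$ with $\sigma X\subset X$, where $\sigma$ is the shift $(\sigma x)_n=x_{n+1}$, $n\ge 1$. A \emph{shift-invariant measure} on $K^{\mathbb N}$ is a $\sigma$-invariant Borel probability measure supported by $K^{\mathbb N}$. A \emph{joining} of two such measures $\mu,\nu$ is a $\sigma\times\sigma$-invariant measure with marginals $\mu$ and $\nu$, and $$\mathrm{corr}(\mu,\nu)=\sup_{\xi}\Bigl|\int x_1\overline{y_1}\,d\xi-\int x_1\,d\mu\int\overline{y_1}\,d\nu\Bigr|,$$ the supremum being over all joinings $\xi$ of $\mu$ and $\nu$. The measures are \emph{uncorrelated} if $\mathrm{corr}(\mu,\nu)=0$ and \emph{correlated} otherwise. We say that $\mu$ is \emph{uncorrelated to any ergodic measure} if $\mathrm{corr}(\mu,\nu)=0$ for every compact $K\subset\mathbb C$ and every ergodic shift-invariant measure $\nu$ on $K^{\mathbb N}$. A \emph{conjugacy} between subshifts is a homeomorphism commuting with the shift. For $t,s\in[0,1)$ let $\varphi(t,s)=-1$ if $0\le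 s<t$ and $\varphi(t,s)=1$ otherwise. For an irrational $\alpha\in(0,1)$ let $\mu$ be the image of the measure $dt\times ds\times d\kappa$ on $S_1\times S_1\times\{-1,1\}$ (Lebesgue measures and the uniform probability measure) under the map $(t,s,\kappa)\mapsto(x_n)_{n\ge1}\in\{-1,1\}^{\mathbb N}$, $$x_n=\kappa\prod_{i=0}^{n-2}\varphi(t,s+i\alpha).$$ This is the symbolic representation, by the itineraries of the last coordinate, of the transformation $(t,s,\kappa)\mapsto(t,s+\alpha,\kappa\,\varphi(t,s))$. For $t\in S_1$ let $\nu_t$ be the distribution of the sequence $c_t(s)=(\varphi(t,s+(n-1)\alpha))_{n\ge1}$ for $s$ distributed according to Lebesgue measure on $S_1$; $\nu_\alpha$ is the classical Sturmian representation of the rotation by $\alpha$. Finally let $$\Pi'(x)_n=\tfrac34x_n+\tfrac14x_nx_{n+1}.$$ Then: \begin{enumerate} \item The property of being uncorrelated to any ergodic measure is not a conjugacy invariant, not even for conjugacies between subshifts over finite alphabets contained in the unit disc. \item For every subshift $X\subset\{-1,1\}^{\mathbb N}$, the image $\Pi'(X)$ is a subshift over $\{-1,-\frac12,\frac12,1\}$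 and $\Pi'$ is a conjugacy of $X$ onto $\Pi'(X)$. \item For every irrational $\alpha\in(0,1)$: $\mu$ is a shift-invariant measure on $\{-1,1\}^{\mathbb N}$ that is uncorrelated to any ergodic measure; its image $\Pi'(\mu)$ is a shift-invariant measure on $\{-1,-\frac12,\frac12,1\}^{\mathbb N}$; for every $t\ne0$ in $S_1$ the coding $c_t$ is injective and satisfies $c_t(s+\alpha)=\sigma(c_t(s))$ for all $s\in S_1$, and $\nu_t$ is an ergodic shift-invariant measure on $\{-1,1\}^{\mathbb N}$; and $\Pi'(\mu)$ is correlated to the Sturmian measure $\nu_\alpha$, and more generally to $\nu_t$ for every $t\ne0$. \end{enumerate} -/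

import Mathlib

open MeasureTheory
open scoped ENNReal ComplexConjugate

noncomputable section

namespace SymbolicCorrelation

/-! ### One-sided complex sequences, subshifts, shift-invariant measures

Sequences are indexed by `ℕ` starting at `0`, so `x 0` is the first symbol. -/

/-- The (one-sided) shift transformation. -/
def shift (x : ℕ → ℂ) : ℕ → ℂ := fun n => x (n + 1)

/-- The set `K^ℕ` of all sequences over the alphabet `K`. -/
def sequences (K : Set ℂ) : Set (ℕ → ℂ) := {x | ∀ n, x n ∈ K}

/-- `X` is a subshift over the alphabet `K`: a closed forward shift-invariant subset of `K^ℕ`. -/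
def IsSubshift (K : Set ℂ) (X : Set (ℕ → ℂ)) : Prop :=
  X ⊆ sequences K ∧ IsClosed X ∧ Set.MapsTo shift X X

/-- `μ` is a shift-invariant Borel probability measure supported by `K^ℕ`. -/
structure IsShiftMeasure (K : Set ℂ) (μ : Measure (ℕ → ℂ)) : Prop where
  prob : IsProbabilityMeasure μ
  invariant : MeasurePreserving shift μ μ
  supported : ∀ᵐ x ∂μ, x ∈ sequences K

/-- `μ` is an ergodic shift-invariant Borel probability measure supported by `K^ℕ`. -/
structure IsErgodicShiftMeasure (K : Set ℂ) (μ : Measure (ℕ → ℂ)) : Prop extends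
    IsShiftMeasure K μ where
  ergodic : Ergodic shift μ

/-! ### Correlation of measures -/

/-- `ξ` is a joining of `μ` and `ν`: a measure on the product, invariant under the product of the
shifts, with marginals `μ` and `ν`. -/
structure IsJoining (ξ : Measure ((ℕ → ℂ) × (ℕ → ℂ))) (μ ν : Measure (ℕ → ℂ)) : Prop where
  fst_eq : ξ.map Prod.fst = μ
  snd_eq : ξ.map Prod.snd = ν
  invariant : MeasurePreserving (Prod.map shift shift) ξ ξ

/-- The correlation of two shift-invariant measures: the supremum over all joinings `ξ` of
`|∫ x₁ * conj y₁ dξ - ∫ x₁ dμ * ∫ conj y₁ dν|`. -/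
def corr (μ ν : Measure (ℕ → ℂ)) : ℝ≥0∞ :=
  ⨆ (ξ : Measure ((ℕ → ℂ) × (ℕ → ℂ))) (_ : IsJoining ξ μ ν),
    ‖(∫ p, p.1 0 * conj (p.2 0) ∂ξ) - (∫ x, x 0 ∂μ) * ∫ y, conj (y 0) ∂ν‖ₑ

/-- `μ` is uncorrelated to any ergodic measure supported by a complex-valued subshift (over an
arbitrary compact alphabet, in particular over any finite subset of the unit disc). -/
def UncorrelatedToErgodic (μ : Measure (ℕ → ℂ)) : Prop :=
  ∀ (K : Set ℂ) (ν : Measure (ℕ → ℂ)),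
    IsCompact K → IsErgodicShiftMeasure K ν → corr μ ν = 0

/-! ### Topological conjugacy -/

/-- `Φ` restricts to a topological conjugacy of `X` onto `Y`: a homeomorphism of `X` onto `Y`
commuting with the shift. -/
def IsConjugacy (X Y : Set (ℕ → ℂ)) (Φ : (ℕ → ℂ) → (ℕ → ℂ)) : Prop :=
  (∃ h : X ≃ₜ Y, ∀ x : X, (h x : ℕ → ℂ) = Φ x) ∧ ∀ x ∈ X, Φ (shift x) = shift (Φ x)

/-- A property of shift-invariant measures is a conjugacy invariant if it is preserved when the
measure is carried by a topological conjugacy between two subshifts over finite alphabets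
contained in the unit disc. -/
def IsConjugacyInvariant (P : Measure (ℕ → ℂ) → Prop) : Prop :=
  ∀ (K L : Set ℂ) (X Y : Set (ℕ → ℂ)) (Φ : (ℕ → ℂ) → (ℕ → ℂ)) (μ : Measure (ℕ → ℂ)),
    K.Finite → K ⊆ Metric.closedBall 0 1 → L.Finite → L ⊆ Metric.closedBall 0 1 →
    IsSubshift K X → IsSubshift L Y → IsConjugacy X Y Φ →
    IsShiftMeasure K μ → (∀ᵐ x ∂μ, x ∈ X) → (P μ ↔ P (μ.map Φ))

/-! ### The `ℤ₂`-extension and its symbolic representation -/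

/-- The representative in `[0, 1)` of a point of the circle `ℝ / ℤ`. -/
def rep (s : UnitAddCircle) : ℝ := (AddCircle.equivIco (1 : ℝ) 0 s : ℝ)

/-- The cocycle `φ(t, s)`, equal to `-1` if `0 ≤ s < t` and to `1` otherwise
(`t`, `s` in `[0, 1)`). -/
def cocycle (t s : UnitAddCircle) : ℤˣ := open Classical in if rep s < rep t then -1 else 1

/-- The Haar (uniform) probability measure on the two-element group `{-1, 1}`. -/
def haarSign : Measure ℤˣ :=
  (2⁻¹ : ℝ≥0∞) • Measure.dirac 1 + (2⁻¹ : ℝ≥0∞) • Measure.dirac (-1)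

/-- The skew product `(t, s, κ) ↦ (t, s + α, κ φ(t, s))`. -/
def skewProduct (α : ℝ) (p : UnitAddCircle × UnitAddCircle × ℤˣ) :
    UnitAddCircle × UnitAddCircle × ℤˣ :=
  (p.1, p.2.1 + (α : UnitAddCircle), p.2.2 * cocycle p.1 p.2.1)

/-- The itinerary of the last coordinate under the skew product. -/
def itinerary (α : ℝ) (p : UnitAddCircle × UnitAddCircle × ℤˣ) : ℕ → ℂ :=
  fun n => ((((skewProduct α)^[n] p).2.2 : ℤ) : ℂ)

/-- The symbolic representation on `{-1, 1}^ℕ` of the measure `dt × ds × dκ`. -/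
def extensionMeasure (α : ℝ) : Measure (ℕ → ℂ) :=
  ((volume : Measure UnitAddCircle).prod
    ((volume : Measure UnitAddCircle).prod haarSign)).map (itinerary α)

/-- The sequence obtained by reading the function `φ(t, ·)` along the orbit of `s` under the
rotation by `α`. -/
def rotationCode (α : ℝ) (t s : UnitAddCircle) : ℕ → ℂ :=
  fun n => ((cocycle t (s + n • (α : UnitAddCircle)) : ℤ) : ℂ)

/-- The symbolic measure of the rotation by `α` read through `φ(t, ·)`: the distribution of
`rotationCode α t s` for `s` distributed according to Lebesgue measure. -/
def rotationMeasure (α : ℝ) (t : UnitAddCircle) : Measure (ℕ → ℂ) :=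
  (volume : Measure UnitAddCircle).map (rotationCode α t)

/-- The classical Sturmian representation of the rotation by `α`, given by coding the arc
`[0, α)` and its complement. -/
def sturmianMeasure (α : ℝ) : Measure (ℕ → ℂ) := rotationMeasure α (α : UnitAddCircle)

/-! ### The code -/

/-- The code `Π'(x)_n = (3/4) x_n + (1/4) x_n x_{n+1}`. -/
def code (x : ℕ → ℂ) : ℕ → ℂ := fun n => 3 / 4 * x n + 1 / 4 * (x n * x (n + 1))

/-- The explicit formula `x_n = κ ∏_{i < n} φ(t, s + iα)` (indices starting at `0`). -/
theorem itinerary_apply (α : ℝ) (t s : UnitAddCircle) (κ : ℤˣ) (n : ℕ) :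
    itinerary α (t, s, κ) n =
      (((κ * ∏ i ∈ Finset.range n, cocycle t (s + i • (α : UnitAddCircle)) : ℤˣ) : ℤ) : ℂ) := by
  have h : ∀ n : ℕ, (skewProduct α)^[n] (t, s, κ) =
      (t, s + n • (α : UnitAddCircle),
        κ * ∏ i ∈ Finset.range n, cocycle t (s + i • (α : UnitAddCircle))) := by
    intro n
    induction n with
    | zero => simp
    | succ n ih =>
      rw [Function.iterate_succ_apply', ih, Finset.prod_range_succ]
      simp [skewProduct, add_smul, add_assoc, mul_assoc]
  simp only [itinerary, h]

end SymbolicCorrelation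

end

/-!
The skew product `(t, s, κ) ↦ (t, s + α, κ φ(t, s))` is not ergodic: it preserves every fibre over
a fixed `t`, and the claim that its sign coordinate `κ` is uncorrelated to every ergodic system
rests on the fact that `t` cannot be seen by an ergodic system while the behaviour of `κ` depends
on `t` in an essential way.

Let `ξ` be an invariant coupling of the skew product with an ergodic system `(Y, R, ν)` and let `g`
be a bounded function on `Y`. The coordinate `t` is invariant, so it is independent of `y`
(`map_prodMk_eq_prod_of_ergodic`). Along coprime approximations `p / q` of `α` with
`|qα - p| < 1 / q`, write the conditional mean given `t` of `κ` times `g (R^q y)` in two ways.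

* By independence it is an integral over `Y` of `E[κ | t, y] g (R^q y)` with respect to `ν`; since
  the functions `g ∘ R^q` have a subsequence converging weakly in `L²(ν)`
  (`exists_subseq_tendsto_integral_mul`), it converges for almost every `t` along one subsequence
  that does not depend on `t`.
* By invariance it is an integral over `s` of the cocycle product over the past `q` steps times a
  fixed function of `s`. Since `qα` is close to an integer, the cocycle product is nearly invariant
  under the rotation by `α`, hence nearly uncorrelated to that function
  (`tendsto_integral_pastProd_mul_sub`), and the integral is asymptotically `I_q(t) E[κ g(y) | t]`
  with `I_q(t)` the mean of the cocycle product over the circle.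

However, `I_q(t)` diverges for almost every `t` along each sequence of such approximations
(`ae_not_tendsto_meanSign`). Indeed `I_q(t + α)` is close to `(-1)^p I_q(t)`, and
`I_q(t + 1) = (-1)^q I_q(t)` when `t` ranges over the real line. On the double cover of the circle,
ergodicity of the rotation by `2α` shows that convergence on a set of positive measure would be
convergence to a constant almost everywhere, and this constant is zero because `p` and `q` are not
both even; but the mean of `|I_q|` is bounded below (`le_integral_abs_meanSign`). So
`E[κ g(y) | t] = 0` for almost every `t` (`integral_sign_mul_eq_zero`). The symbolic version follows
because the itinerary determines `(t, s, κ)` when `t ≠ 0` (`itinerary_injOn`), so that every joining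
of the symbolic measures comes from a coupling as above.

The code `Π'` adds to `¾ κ` the term `¼ x₁ x₂ = ¼ φ(t, s)`, whose mean over `t` is `(2s - 1) / 4`.
This is a function of the ergodic coordinate `s`, and pairing it with the coding of `s` by the arc
`[0, t₀)` gives the correlation `t₀ (1 - t₀) / 2 ≠ 0` (`corr_map_code_rotationMeasure_ne_zero`).
-/

noncomputable section

namespace SymbolicCorrelation

open Filter Topology

/-! ### The circle -/

instance : IsProbabilityMeasure (volume : Measure UnitAddCircle) := ⟨UnitAddCircle.measure_univ⟩

theorem rep_mem (s : UnitAddCircle) : rep s ∈ Set.Ico (0 : ℝ) 1 := by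
  have h := (AddCircle.equivIco (1 : ℝ) 0 s).2
  exact ⟨h.1, h.2.trans_eq (zero_add 1)⟩

@[simp] theorem coe_rep (s : UnitAddCircle) : ((rep s : ℝ) : UnitAddCircle) = s :=
  AddCircle.coe_equivIco

theorem rep_coe (x : ℝ) : rep (x : UnitAddCircle) = Int.fract x := by
  simp [rep]

theorem measurable_rep : Measurable rep :=
  measurable_subtype_coe.comp (AddCircle.measurableEquivIco 1 0).measurable

theorem rep_injective : Function.Injective rep := fun s t h => by
  rw [← coe_rep s, h, coe_rep]

/-- If rounding up separates `x` from `x - δ`, then an integer lies between them, so `x` is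
`|δ|`-close to `0` on the circle. -/
theorem norm_coe_le_of_ceil_ne {x δ : ℝ} (h : ⌈x⌉ ≠ ⌈x - δ⌉) :
    ‖(x : UnitAddCircle)‖ ≤ |δ| := by
  rw [UnitAddCircle.norm_eq]
  rcases lt_or_gt_of_ne h with h | h
  · refine (round_le x ⌈x⌉).trans ?_
    have h1 := Int.le_ceil x
    have h2 : (⌈x⌉ : ℝ) < x - δ := Int.lt_ceil.1 h
    rw [abs_of_nonpos (by linarith), abs_of_nonpos (by linarith)]
    linarith
  · refine (round_le x ⌈x - δ⌉).trans ?_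
    have h1 := Int.le_ceil (x - δ)
    have h2 : (⌈x - δ⌉ : ℝ) < x := Int.lt_ceil.1 h
    rw [abs_of_nonneg (by linarith), abs_of_nonneg (by linarith)]
    linarith

theorem measureReal_closedBall_le (x : UnitAddCircle) {r : ℝ} (hr : 0 ≤ r) :
    volume.real (Metric.closedBall x r) ≤ 2 * r := by
  rw [measureReal_def, AddCircle.volume_closedBall, ENNReal.toReal_ofReal (by positivity)]
  exact min_le_right _ _

/-- A function bounded by `2` and vanishing outside a closed ball of radius `r` has integral at
most `4 r`. -/
theorem integral_le_of_eq_zero_off_closedBall {f : UnitAddCircle → ℝ} {x : UnitAddCircle} {r : ℝ}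
    (hr : 0 ≤ r) (h0 : ∀ s, s ∉ Metric.closedBall x r → f s = 0) (h2 : ∀ s, f s ≤ 2) :
    ∫ s, f s ≤ 4 * r := by
  have h : ∀ s, f s ≤ (Metric.closedBall x r).indicator (fun _ => (2 : ℝ)) s := by
    intro s
    by_cases hs : s ∈ Metric.closedBall x r
    · simpa [hs] using h2 s
    · simp [hs, h0 s hs]
  have hi : Integrable ((Metric.closedBall x r).indicator (fun _ => (2 : ℝ)))
      (volume : Measure UnitAddCircle) :=
    (integrable_const _).indicator Metric.isClosed_closedBall.measurableSet
  have hle : ∫ s, f s ≤ ∫ s, (Metric.closedBall x r).indicator (fun _ => (2 : ℝ)) s := by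
    by_cases hf : Integrable f volume
    · exact integral_mono hf hi h
    · rw [integral_undef hf]
      exact integral_nonneg fun s => Set.indicator_nonneg (fun _ _ => by norm_num) s
  refine hle.trans ?_
  rw [integral_indicator Metric.isClosed_closedBall.measurableSet]
  have := measureReal_closedBall_le x hr
  simp
  linarith

instance : MeasurableSingletonClass ℤˣ :=
  ⟨fun u => ⟨{(u : ℤ)}, trivial, by ext v; simp [Units.ext_iff]⟩⟩

/-! ### The cocycle along the real line -/

/-- The cocycle `φ(t, s)` for real `t` and `s`: the parity of the number of integers `k` with
`s + k ∈ [0, t)`, counted negatively if `t < 0`. -/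
def signAt (t s : ℝ) : ℤˣ := (⌈t - s⌉ + ⌊s⌋).negOnePow

/-- The cocycle product `∏_{i < q} φ(t, s + iα)` for real `t` and `s`. -/
def signProd (α : ℝ) (q : ℕ) (t s : ℝ) : ℤˣ := ∏ i ∈ Finset.range q, signAt t (s + i * α)

/-- The mean `∫ ∏_{i < q} φ(t, s + iα) ds` of the cocycle product over the circle. -/
def meanSign (α : ℝ) (q : ℕ) (t : ℝ) : ℝ :=
  ∫ s : UnitAddCircle, ((signProd α q t (rep s) : ℤ) : ℝ)

theorem signAt_add_intCast (t s : ℝ) (k : ℤ) : signAt t (s + k) = signAt t s := by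
  unfold signAt
  rw [← sub_sub, Int.ceil_sub_intCast, Int.floor_add_intCast]
  congr 1
  ring

theorem cocycle_coe (t : UnitAddCircle) (s : ℝ) :
    cocycle t (s : UnitAddCircle) = signAt (rep t) s := by
  obtain ⟨h0, h1⟩ := rep_mem t
  have hs : signAt (rep t) s = signAt (rep t) (Int.fract s) := by
    conv_lhs => rw [← Int.fract_add_floor s]
    exact signAt_add_intCast _ _ _
  have f0 := Int.fract_nonneg s
  have f1 := Int.fract_lt_one s
  rw [hs, cocycle, rep_coe, signAt, Int.floor_eq_zero_iff.2 ⟨f0, f1⟩, add_zero]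
  split_ifs with h
  · have : ⌈rep t - Int.fract s⌉ = 1 := by
      rw [Int.ceil_eq_iff]; constructor <;> push_cast <;> linarith
    rw [this, Int.negOnePow_one]
  · have : ⌈rep t - Int.fract s⌉ = 0 := by
      rw [Int.ceil_eq_iff]; constructor <;> push_cast <;> linarith
    rw [this, Int.negOnePow_zero]

theorem signProd_rep (α : ℝ) (q : ℕ) (t s : UnitAddCircle) :
    signProd α q (rep t) (rep s) =
      ∏ i ∈ Finset.range q, cocycle t (s + i • (α : UnitAddCircle)) := by
  refine Finset.prod_congr rfl fun i _ => ?_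
  rw [← cocycle_coe, ← nsmul_eq_mul, AddCircle.coe_add, AddCircle.coe_nsmul, coe_rep]

theorem measurable_signAt : Measurable fun p : ℝ × ℝ => signAt p.1 p.2 := by
  unfold signAt
  exact (measurable_of_countable Int.negOnePow).comp
    ((Int.measurable_ceil.comp (measurable_fst.sub measurable_snd)).add
      (Int.measurable_floor.comp measurable_snd))

theorem measurable_signProd (α : ℝ) (q : ℕ) :
    Measurable fun p : ℝ × ℝ => signProd α q p.1 p.2 := by
  induction q with
  | zero => exact measurable_const
  | succ q ih =>
    have h : Measurable fun p : ℝ × ℝ => signAt p.1 (p.2 + q * α) :=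
      (measurable_signAt.comp (measurable_fst.prodMk (measurable_snd.add_const (q * α))) :)
    have heq : (fun p : ℝ × ℝ => signProd α (q + 1) p.1 p.2) =
        fun p => signProd α q p.1 p.2 * signAt p.1 (p.2 + q * α) :=
      funext fun p => Finset.prod_range_succ _ _
    rw [heq]
    exact ((measurable_of_countable fun u : ℤˣ × ℤˣ => u.1 * u.2).comp (ih.prodMk h) :)

theorem measurable_signProd_real (α : ℝ) (q : ℕ) :
    Measurable fun p : ℝ × ℝ => ((signProd α q p.1 p.2 : ℤ) : ℝ) :=
  (measurable_of_countable (fun u : ℤˣ => ((u : ℤ) : ℝ))).comp (measurable_signProd α q)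

theorem abs_sign_cast (u : ℤˣ) : |((u : ℤ) : ℝ)| = 1 := by
  rcases Int.units_eq_one_or u with rfl | rfl <;> simp

theorem abs_sign_sub_le (u v : ℤˣ) : |((u : ℤ) : ℝ) - ((v : ℤ) : ℝ)| ≤ 2 := by
  refine (abs_sub _ _).trans ?_
  rw [abs_sign_cast, abs_sign_cast]; norm_num

theorem measurable_signProd_rep (α : ℝ) (q : ℕ) (t : ℝ) :
    Measurable fun s : UnitAddCircle => ((signProd α q t (rep s) : ℤ) : ℝ) :=
  ((measurable_signProd_real α q).comp (measurable_const.prodMk measurable_rep) :)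

theorem integrable_signProd_rep (α : ℝ) (q : ℕ) (t : ℝ) :
    Integrable (fun s : UnitAddCircle => ((signProd α q t (rep s) : ℤ) : ℝ)) volume :=
  .of_bound (measurable_signProd_rep α q t).aestronglyMeasurable 1
    (Eventually.of_forall fun _ => (abs_sign_cast _).le)

theorem abs_meanSign_le_one (α : ℝ) (q : ℕ) (t : ℝ) : |meanSign α q t| ≤ 1 := by
  have := norm_integral_le_of_norm_le_const (μ := (volume : Measure UnitAddCircle)) (C := 1)
    (f := fun s => ((signProd α q t (rep s) : ℤ) : ℝ))
    (Eventually.of_forall fun _ => (abs_sign_cast _).le)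
  simpa [meanSign] using this

theorem measurable_meanSign (α : ℝ) (q : ℕ) : Measurable (meanSign α q) := by
  have h : Measurable fun p : ℝ × UnitAddCircle => ((signProd α q p.1 (rep p.2) : ℤ) : ℝ) :=
    ((measurable_signProd_real α q).comp
      (measurable_fst.prodMk (measurable_rep.comp measurable_snd)) :)
  exact h.stronglyMeasurable.integral_prod_right.measurable

theorem meanSign_zero (α : ℝ) (q : ℕ) : meanSign α q 0 = 1 := by
  have h : ∀ s, signProd α q 0 s = 1 := fun s => Finset.prod_eq_one fun i _ => by
    rw [signAt, zero_sub, Int.ceil_neg, neg_add_cancel, Int.negOnePow_zero]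
  simp [meanSign, h]

theorem signAt_add_one (t s : ℝ) : signAt (t + 1) s = -signAt t s := by
  rw [signAt, signAt, add_sub_right_comm, Int.ceil_add_one, add_right_comm, Int.negOnePow_succ]

theorem meanSign_add_one (α : ℝ) (q : ℕ) (t : ℝ) :
    meanSign α q (t + 1) = ((q : ℤ).negOnePow : ℤ) * meanSign α q t := by
  rw [meanSign, meanSign, ← integral_const_mul]
  refine integral_congr_ae (Eventually.of_forall fun s => ?_)
  have h : signProd α q (t + 1) (rep s) = (q : ℤ).negOnePow * signProd α q t (rep s) := by
    simp_rw [signProd, signAt_add_one, Finset.prod_neg, Finset.card_range]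
    rw [Int.negOnePow_def, zpow_natCast]
  simp only [h]
  push_cast
  rfl

/-- Moving the endpoint `t` by `α` shifts the orbit by one step, so that the number of visits
telescopes. -/
theorem signProd_add_angle (α : ℝ) (q : ℕ) (t s : ℝ) :
    signProd α q (t + α) s =
      (⌈t + α - s⌉ - ⌈t + α - s - q * α⌉).negOnePow * signProd α q t s := by
  induction q with
  | zero => simp [signProd]
  | succ q ih =>
    have h : signAt (t + α) (s + q * α) =
        (⌈t + α - s - q * α⌉ - ⌈t + α - s - (q + 1 : ℕ) * α⌉).negOnePow *
          signAt t (s + q * α) := by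
      rw [signAt, signAt, ← Int.negOnePow_add]
      have e1 : t + α - (s + q * α) = t + α - s - q * α := by ring
      have e2 : t - (s + q * α) = t + α - s - (q + 1 : ℕ) * α := by push_cast; ring
      rw [e1, e2, Int.negOnePow_eq_iff]
      ring_nf
      exact Even.zero
    have hs : ∀ t, signProd α (q + 1) t s = signProd α q t s * signAt t (s + q * α) :=
      fun t => Finset.prod_range_succ _ _
    rw [hs, hs, ih, h, mul_mul_mul_comm, ← Int.negOnePow_add, sub_add_sub_cancel]

/-- The mean cocycle product is nearly invariant, up to the sign `(-1)^p`, under the rotation by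
`α`, with error controlled by `|qα - p|`. -/
theorem abs_meanSign_add_angle_sub_le (α : ℝ) (q : ℕ) (p : ℤ) (t : ℝ) :
    |meanSign α q (t + α) - (p.negOnePow : ℤ) * meanSign α q t| ≤ 4 * |q * α - p| := by
  rw [meanSign, meanSign, ← integral_const_mul, ← integral_sub (integrable_signProd_rep _ _ _)
    ((integrable_signProd_rep _ _ _).const_mul _)]
  refine (abs_integral_le_integral_abs).trans ?_
  have hc : ∀ s : ℝ, (((p.negOnePow : ℤˣ) : ℤ) : ℝ) * ((signProd α q t s : ℤ) : ℝ) =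
      (((p.negOnePow * signProd α q t s : ℤˣ) : ℤ) : ℝ) := fun s => by push_cast; rfl
  refine integral_le_of_eq_zero_off_closedBall (x := ((t + α : ℝ) : UnitAddCircle))
    (abs_nonneg _) (fun s hs => ?_) fun s => ?_
  · have hx : ⌈t + α - rep s⌉ = ⌈t + α - rep s - (q * α - p)⌉ := by
      by_contra h
      apply hs
      have := norm_coe_le_of_ceil_ne h
      rwa [AddCircle.coe_sub, coe_rep, ← dist_eq_norm, dist_comm] at this
    have hp : ⌈t + α - rep s⌉ - ⌈t + α - rep s - q * α⌉ = p := by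
      have e : t + α - rep s - (q * α - p) = t + α - rep s - q * α + p := by ring
      rw [hx, e, Int.ceil_add_intCast]
      ring
    rw [hc, signProd_add_angle, hp, sub_self, abs_zero]
  · rw [hc]
    exact abs_sign_sub_le _ _

theorem abs_prod_sign_sub_le (u v : ℕ → ℤˣ) (q : ℕ) :
    |((∏ i ∈ Finset.range q, u i : ℤˣ) : ℤ) - (((∏ i ∈ Finset.range q, v i : ℤˣ) : ℤ) : ℝ)| ≤
      ∑ i ∈ Finset.range q, |((u i : ℤ) : ℝ) - ((v i : ℤ) : ℝ)| := by
  induction q with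
  | zero => simp
  | succ q ih =>
    rw [Finset.prod_range_succ, Finset.prod_range_succ, Finset.sum_range_succ]
    set a := ∏ i ∈ Finset.range q, u i
    set b := ∏ i ∈ Finset.range q, v i
    have h : (((a * u q : ℤˣ) : ℤ) : ℝ) - (((b * v q : ℤˣ) : ℤ) : ℝ) =
        ((a : ℤ) - (b : ℤ) : ℝ) * ((u q : ℤ) : ℝ) +
          ((b : ℤ) : ℝ) * ((u q : ℤ) - (v q : ℤ) : ℝ) := by
      push_cast
      ring
    rw [h]
    refine (abs_add_le _ _).trans ?_
    rw [abs_mul, abs_mul, abs_sign_cast, abs_sign_cast, mul_one, one_mul]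
    linarith

theorem abs_meanSign_add_sub_le (α : ℝ) (q : ℕ) (t u : ℝ) :
    |meanSign α q (t + u) - meanSign α q t| ≤ 4 * q * |u| := by
  rw [meanSign, meanSign, ← integral_sub (integrable_signProd_rep _ _ _)
    (integrable_signProd_rep _ _ _)]
  refine (abs_integral_le_integral_abs).trans ?_
  have hm : ∀ (i : ℕ) (t : ℝ), Measurable fun s : UnitAddCircle =>
      ((signAt t (rep s + i * α) : ℤ) : ℝ) := fun i t =>
    (measurable_of_countable fun u : ℤˣ => ((u : ℤ) : ℝ)).comp
      ((measurable_signAt.comp (measurable_const.prodMk (measurable_rep.add_const (i * α))) :))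
  have hi : ∀ i : ℕ, Integrable (fun s : UnitAddCircle =>
      |((signAt (t + u) (rep s + i * α) : ℤ) : ℝ) - ((signAt t (rep s + i * α) : ℤ) : ℝ)|)
      volume := fun i =>
    .of_bound ((hm i _).sub (hm i _)).norm.aestronglyMeasurable 2
      (Eventually.of_forall fun s => by
        rw [Real.norm_eq_abs, abs_abs]; exact abs_sign_sub_le _ _)
  calc _ ≤ ∫ s : UnitAddCircle, ∑ i ∈ Finset.range q,
          |((signAt (t + u) (rep s + i * α) : ℤ) : ℝ) - ((signAt t (rep s + i * α) : ℤ) : ℝ)| := by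
        refine integral_mono ((integrable_signProd_rep _ _ _).sub
          (integrable_signProd_rep _ _ _)).abs (integrable_finsetSum _ fun i _ => hi i)
          fun s => ?_
        exact abs_prod_sign_sub_le _ _ _
    _ ≤ ∑ i ∈ Finset.range q, 4 * |u| := by
        rw [integral_finsetSum _ fun i _ => hi i]
        refine Finset.sum_le_sum fun i _ => ?_
        refine integral_le_of_eq_zero_off_closedBall
          (x := ((t + u - i * α : ℝ) : UnitAddCircle)) (abs_nonneg _) (fun s hs => ?_)
          fun s => abs_sign_sub_le _ _
        have hx : ⌈t + u - i * α - rep s⌉ = ⌈t + u - i * α - rep s - u⌉ := by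
          by_contra h
          apply hs
          have := norm_coe_le_of_ceil_ne h
          rwa [AddCircle.coe_sub, coe_rep, ← dist_eq_norm, dist_comm] at this
        have e1 : t + u - (rep s + i * α) = t + u - i * α - rep s := by ring
        have e2 : t - (rep s + i * α) = t + u - i * α - rep s - u := by ring
        rw [signAt, signAt, e1, e2, hx, sub_self, abs_zero]
    _ = 4 * q * |u| := by
        rw [Finset.sum_const, Finset.card_range, nsmul_eq_mul]; ring

/-! ### Cocycle products on the circle -/

/-- The cocycle product `∏_{i < q} φ(t, s + iα)` for `t` and `s` on the circle. -/
def cocycleProd (α : ℝ) (q : ℕ) (t s : UnitAddCircle) : ℤˣ :=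
  ∏ i ∈ Finset.range q, cocycle t (s + i • (α : UnitAddCircle))

theorem measurable_cocycle : Measurable fun p : UnitAddCircle × UnitAddCircle =>
    cocycle p.1 p.2 := by
  have h : (fun p : UnitAddCircle × UnitAddCircle => cocycle p.1 p.2) =
      fun p => signAt (rep p.1) (rep p.2) := funext fun p => by
    rw [← cocycle_coe, coe_rep]
  rw [h]
  exact (measurable_signAt.comp ((measurable_rep.comp measurable_fst).prodMk
    (measurable_rep.comp measurable_snd)) :)

theorem measurable_cocycleProd (α : ℝ) (q : ℕ) :
    Measurable fun p : UnitAddCircle × UnitAddCircle => cocycleProd α q p.1 p.2 := by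
  have h : (fun p : UnitAddCircle × UnitAddCircle => cocycleProd α q p.1 p.2) =
      fun p => signProd α q (rep p.1) (rep p.2) := funext fun p => (signProd_rep _ _ _ _).symm
  rw [h]
  exact ((measurable_signProd α q).comp ((measurable_rep.comp measurable_fst).prodMk
    (measurable_rep.comp measurable_snd)) :)

theorem integral_cocycleProd (α : ℝ) (q : ℕ) (t : UnitAddCircle) :
    ∫ s, ((cocycleProd α q t s : ℤ) : ℝ) = meanSign α q (rep t) := by
  simp_rw [meanSign, signProd_rep, cocycleProd]

theorem cocycleProd_add_angle (α : ℝ) (q : ℕ) (t s : UnitAddCircle) :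
    cocycleProd α q t (s + α) =
      cocycle t s * cocycle t (s + q • (α : UnitAddCircle)) * cocycleProd α q t s := by
  have h := Finset.prod_range_succ (fun i : ℕ => cocycle t (s + i • (α : UnitAddCircle))) q
  rw [Finset.prod_range_succ'] at h
  simp_rw [succ_nsmul', ← add_assoc] at h
  rw [zero_smul, add_zero] at h
  change cocycleProd α q t (s + α) * _ = cocycleProd α q t s * _ at h
  rw [mul_assoc, mul_comm (cocycle t (s + _)), ← h, mul_comm (cocycleProd α q t _), ← mul_assoc,
    Int.units_mul_self, one_mul]

theorem cocycle_add_eq {t s : UnitAddCircle} {δ : ℝ}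
    (ht : s ∉ Metric.closedBall t |δ|) (h0 : s ∉ Metric.closedBall (0 : UnitAddCircle) |δ|) :
    cocycle t (s + (δ : UnitAddCircle)) = cocycle t s := by
  have hx : ⌈rep t - rep s⌉ = ⌈rep t - rep s - δ⌉ := by
    by_contra h
    apply ht
    have := norm_coe_le_of_ceil_ne h
    rwa [AddCircle.coe_sub, coe_rep, coe_rep, ← dist_eq_norm, dist_comm] at this
  have hy : ⌈-rep s⌉ = ⌈-rep s - δ⌉ := by
    by_contra h
    apply h0
    have := norm_coe_le_of_ceil_ne h
    rwa [AddCircle.coe_neg, coe_rep, norm_neg, ← dist_zero_right] at this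
  have e : ((rep s + δ : ℝ) : UnitAddCircle) = s + δ := by rw [AddCircle.coe_add, coe_rep]
  rw [← e, cocycle_coe, signAt, ← sub_sub, ← hx]
  conv_rhs => rw [← coe_rep s, cocycle_coe, signAt]
  rw [Int.ceil_neg, ← neg_add', Int.ceil_neg, neg_inj] at hy
  rw [hy]

/-- The cocycle product over `q` steps is nearly invariant under the rotation by `α` if `qα` is
close to an integer. -/
theorem integral_abs_cocycleProd_add_angle_sub_le (α : ℝ) (q : ℕ) (p : ℤ) (t : UnitAddCircle) :
    ∫ s, |((cocycleProd α q t (s + α) : ℤ) : ℝ) - ((cocycleProd α q t s : ℤ) : ℝ)| ≤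
      8 * |q * α - p| := by
  set δ : ℝ := q * α - p
  have hδ : q • (α : UnitAddCircle) = (δ : UnitAddCircle) := by
    have : (δ : UnitAddCircle) = ((q * α : ℝ) : UnitAddCircle) - ((p : ℝ) : UnitAddCircle) :=
      AddCircle.coe_sub _ _ _
    rw [this, ← nsmul_eq_mul, AddCircle.coe_nsmul]
    have hp : ((p : ℝ) : UnitAddCircle) = 0 := by
      rw [AddCircle.coe_eq_zero_iff]; exact ⟨p, by simp⟩
    rw [hp, sub_zero]
  have hi : ∀ x : UnitAddCircle, Integrable ((Metric.closedBall x |δ|).indicator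
      (fun _ => (2 : ℝ))) (volume : Measure UnitAddCircle) := fun x =>
    (integrable_const _).indicator Metric.isClosed_closedBall.measurableSet
  have hb : ∀ x : UnitAddCircle,
      ∫ s, (Metric.closedBall x |δ|).indicator (fun _ => (2 : ℝ)) s ≤ 4 * |δ| := fun x =>
    integral_le_of_eq_zero_off_closedBall (abs_nonneg _)
      (fun s hs => Set.indicator_of_notMem hs _)
      (fun s => Set.indicator_le_self' (fun _ _ => by norm_num) s)
  calc _ ≤ ∫ s, ((Metric.closedBall t |δ|).indicator (fun _ => (2 : ℝ)) s +
          (Metric.closedBall 0 |δ|).indicator (fun _ => (2 : ℝ)) s) := by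
        refine integral_mono_of_nonneg (Eventually.of_forall fun s => abs_nonneg _)
          ((hi t).add (hi 0)) (Eventually.of_forall fun s => ?_)
        have hn : ∀ x : UnitAddCircle,
            0 ≤ (Metric.closedBall x |δ|).indicator (fun _ => (2 : ℝ)) s := fun x =>
          Set.indicator_nonneg (fun _ _ => by norm_num) s
        have h2 := abs_sign_sub_le (cocycleProd α q t (s + α)) (cocycleProd α q t s)
        by_cases ht : s ∈ Metric.closedBall t |δ|
        · have := hn 0
          simp only [Set.indicator_of_mem ht]
          linarith
        by_cases h0 : s ∈ Metric.closedBall (0 : UnitAddCircle) |δ|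
        · have := hn t
          simp only [Set.indicator_of_mem h0]
          linarith
        have : cocycleProd α q t (s + α) = cocycleProd α q t s := by
          rw [cocycleProd_add_angle, hδ, cocycle_add_eq ht h0, Int.units_mul_self, one_mul]
        simp only [this, sub_self, abs_zero]
        exact add_nonneg (hn t) (hn 0)
    _ ≤ 8 * |δ| := by
        rw [integral_add (hi t) (hi 0)]
        linarith [hb t, hb 0]

/-! ### Oscillation of the means along good rational approximations -/

/-- Representatives of uniformly distributed points are uniformly distributed on `(0, 1]`. -/
theorem measurePreserving_rep :
    MeasurePreserving rep (volume : Measure UnitAddCircle) (volume.restrict (Set.Ioc 0 1)) := by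
  have hmk : MeasurePreserving (β := UnitAddCircle) ((↑) : ℝ → UnitAddCircle)
      (volume.restrict (Set.Ioc (0 : ℝ) 1)) := by
    simpa only [zero_add] using UnitAddCircle.measurePreserving_mk 0
  refine ⟨measurable_rep, ?_⟩
  rw [← hmk.map_eq, Measure.map_map measurable_rep hmk.measurable]
  have h : rep ∘ ((↑) : ℝ → UnitAddCircle) =ᵐ[volume.restrict (Set.Ioc (0 : ℝ) 1)] id := by
    have h1 : ∀ᵐ x ∂(volume.restrict (Set.Ioc (0 : ℝ) 1)), x ≠ 1 :=
      ae_restrict_of_ae (Measure.ae_ne volume 1)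
    filter_upwards [h1, ae_restrict_mem measurableSet_Ioc] with x hx hm
    rw [Function.comp_apply, rep_coe, id, Int.fract_eq_self]
    exact ⟨hm.1.le, lt_of_le_of_ne hm.2 hx⟩
  rw [Measure.map_congr h, Measure.map_id]

theorem le_measureReal_rep_sub_lt (a : UnitAddCircle) {r : ℝ} (h1 : r ≤ 1) :
    r ≤ volume.real {x : UnitAddCircle | rep (x - a) < r} := by
  have hms : MeasurableSet {x : UnitAddCircle | rep x < r} := measurable_rep measurableSet_Iio
  have h : volume.real {x : UnitAddCircle | rep (x - a) < r} =
      volume.real {x : UnitAddCircle | rep x < r} := by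
    rw [measureReal_def, measureReal_def, ← (measurePreserving_sub_right volume a).measure_preimage
      hms.nullMeasurableSet]
    rfl
  have h2 : volume.real {x : UnitAddCircle | rep x < r} =
      (volume.restrict (Set.Ioc (0 : ℝ) 1)).real (Set.Iio r) := by
    rw [measureReal_def, measureReal_def, ← measurePreserving_rep.measure_preimage
      measurableSet_Iio.nullMeasurableSet]
    rfl
  rw [h, h2, measureReal_restrict_apply measurableSet_Iio]
  have h3 : Set.Ioo 0 r ⊆ Set.Iio r ∩ Set.Ioc 0 1 := fun x hx =>
    ⟨hx.2, hx.1, (hx.2.trans_le h1).le⟩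
  have h4 := measureReal_mono (μ := volume) h3
    ((measure_mono Set.inter_subset_right).trans_lt (by simp)).ne
  refine le_trans ?_ h4
  rw [Real.volume_real_Ioo]
  simp

theorem abs_meanSign_add_one (α : ℝ) (q : ℕ) (t : ℝ) :
    |meanSign α q (t + 1)| = |meanSign α q t| := by
  rw [meanSign_add_one, abs_mul, abs_sign_cast, one_mul]

theorem abs_meanSign_fract (α : ℝ) (q : ℕ) (t : ℝ) :
    |meanSign α q (Int.fract t)| = |meanSign α q t| := by
  have h : Function.Periodic (fun t => |meanSign α q t|) 1 := abs_meanSign_add_one α q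
  simpa using h.sub_zsmul_eq (x := t) ⌊t⌋

/-- Starting from `I_q(0) = 1` and moving by `m` rotations and a remainder `u`, the mean cocycle
product stays large in absolute value. -/
theorem le_abs_meanSign (α : ℝ) (q : ℕ) (p : ℤ) (m : ℕ) (u : ℝ) :
    1 - 4 * q * |u| - 4 * m * |q * α - p| ≤ |meanSign α q (m * α + u)| := by
  induction m with
  | zero =>
    have h1 := abs_meanSign_add_sub_le α q 0 u
    rw [meanSign_zero, zero_add] at h1
    have h2 := (abs_le.1 h1).1
    have h3 := le_abs_self (meanSign α q u)
    simp only [Nat.cast_zero, zero_mul, mul_zero, zero_add]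
    linarith
  | succ m ih =>
    have h1 := abs_meanSign_add_angle_sub_le α q p (m * α + u)
    have h2 := abs_sub_abs_le_abs_sub ((p.negOnePow : ℤ) * meanSign α q (m * α + u))
      (meanSign α q (m * α + u + α))
    rw [abs_mul, abs_sign_cast, one_mul, abs_sub_comm] at h2
    have e : ((m + 1 : ℕ) : ℝ) * α + u = m * α + u + α := by push_cast; ring
    rw [e]
    push_cast
    linarith

/-- Along a rational approximation `p / q` of `α` with `|qα - p| < 1 / q`, the mean cocycle
products do not tend to `0` in mean: they are at least `1 / 2` in absolute value on about `q / 32`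
disjoint arcs of length `1 / (16 q)`, starting at the points `mα`. -/
theorem le_integral_abs_meanSign {α : ℝ} {q : ℕ} {p : ℤ} (hq : 0 < q) (hcop : IsCoprime (q : ℤ) p)
    (happ : |q * α - p| < 1 / q) :
    1 / 1024 ≤ ∫ t : UnitAddCircle, |meanSign α q (rep t)| := by
  have hq0 : (0 : ℝ) < q := by exact_mod_cast hq
  have hq1 : (1 : ℝ) ≤ q := by exact_mod_cast hq
  set r : ℝ := 1 / (16 * q) with hr
  have hqr : q * r = 1 / 16 := by rw [hr]; field_simp
  have hr0 : 0 < r := by positivity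
  have hr1 : r ≤ 1 := by nlinarith
  have happ' : q * |q * α - p| < 1 := by
    rw [lt_div_iff₀ hq0] at happ; linarith
  set M := q / 32 + 1
  let E : ℕ → Set UnitAddCircle := fun m => {x | rep (x - ((m * α : ℝ) : UnitAddCircle)) < r}
  have hm32 : ∀ m ∈ Finset.range M, (32 * m : ℝ) ≤ q := fun m hm => by
    have : 32 * m ≤ q := by
      have := Finset.mem_range.1 hm
      omega
    exact_mod_cast this
  have hE : ∀ m, MeasurableSet (E m) := fun m =>
    (measurable_rep.comp (measurable_id.sub_const _)) measurableSet_Iio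
  -- a point common to two arcs would give a multiple `(m' - m) α` that is too close to an integer
  have key : ∀ m ∈ Finset.range M, ∀ m' ∈ Finset.range M, m < m' → Disjoint (E m) (E m') := by
    intro m hm m' hm' hlt
    rw [Set.disjoint_left]
    intro x hx hx'
    have h1 := (rep_mem (x - ((m * α : ℝ) : UnitAddCircle))).1
    have h1' := (rep_mem (x - ((m' * α : ℝ) : UnitAddCircle))).1
    change rep (x - ((m * α : ℝ) : UnitAddCircle)) < r at hx
    change rep (x - ((m' * α : ℝ) : UnitAddCircle)) < r at hx'
    set u := rep (x - ((m * α : ℝ) : UnitAddCircle)) with hu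
    set u' := rep (x - ((m' * α : ℝ) : UnitAddCircle)) with hu'
    have hk : (((m' - m) * α - (u - u') : ℝ) : UnitAddCircle) = 0 := by
      rw [sub_mul, AddCircle.coe_sub, AddCircle.coe_sub, AddCircle.coe_sub, hu, hu', coe_rep,
        coe_rep]
      abel
    obtain ⟨k, hk⟩ := (AddCircle.coe_eq_zero_iff 1).1 hk
    rw [zsmul_eq_mul, mul_one] at hk
    have hd : q * |(m' - m : ℝ) * α - k| < 1 / 16 := by
      rw [hk, ← hqr]
      refine mul_lt_mul_of_pos_left ?_ hq0
      rw [sub_sub_cancel, abs_lt]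
      constructor <;> linarith
    have hdm : (32 * (m' - m : ℝ)) ≤ q := by
      have := hm32 m' hm'
      have h0 : (0 : ℝ) ≤ m := Nat.cast_nonneg m
      linarith
    have hmm : (0 : ℝ) < m' - m := by
      have : (m : ℝ) < m' := by exact_mod_cast hlt
      linarith
    -- the integer `(m' - m) p - k q` is smaller than `1` in absolute value, so it vanishes, and `q`
    -- would divide `m' - m`
    have hint : |((m' - m : ℤ) * p - k * q : ℤ)| < 1 := by
      have : |((m' : ℝ) - m) * p - k * q| < 1 := by
        have e : ((m' : ℝ) - m) * p - k * q =
            q * ((m' - m : ℝ) * α - k) - (m' - m) * (q * α - p) := by ring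
        rw [e]
        refine (abs_sub _ _).trans_lt ?_
        rw [abs_mul, abs_mul, abs_of_pos hq0, abs_of_pos hmm]
        have : 32 * ((m' - m : ℝ) * |q * α - p|) ≤ q * |q * α - p| := by
          rw [← mul_assoc]
          exact mul_le_mul_of_nonneg_right hdm (abs_nonneg _)
        linarith
      exact_mod_cast this
    have hzero := Int.abs_lt_one_iff.1 hint
    have hdvd : (q : ℤ) ∣ (m' - m : ℤ) :=
      hcop.dvd_of_dvd_mul_right ⟨k, by linarith⟩
    have hle := Int.le_of_dvd (by omega) hdvd
    have hle' : (q : ℝ) ≤ m' - m := by exact_mod_cast hle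
    linarith
  have hdisj : Set.PairwiseDisjoint (↑(Finset.range M)) E := by
    intro m hm m' hm' hne
    rcases lt_or_gt_of_ne hne with h | h
    · exact key m hm m' hm' h
    · exact (key m' hm' m hm h).symm
  set A := ⋃ m ∈ Finset.range M, E m
  have hA : MeasurableSet A := Finset.measurableSet_biUnion _ fun m _ => hE m
  have hvol : 1 / 512 ≤ volume.real A := by
    rw [measureReal_biUnion_finset hdisj fun m _ => hE m]
    calc (1 / 512 : ℝ) ≤ M * r := by
          have hM : (q : ℝ) ≤ 32 * M := by
            have : q ≤ 32 * M := by omega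
            exact_mod_cast this
          nlinarith
      _ = ∑ m ∈ Finset.range M, r := by simp
      _ ≤ _ := Finset.sum_le_sum fun m _ => le_measureReal_rep_sub_lt _ hr1
  have hint : Integrable (fun t : UnitAddCircle => |meanSign α q (rep t)|) volume :=
    .of_bound ((measurable_meanSign α q).comp measurable_rep).norm.aestronglyMeasurable 1
      (Eventually.of_forall fun t => by
        rw [Real.norm_eq_abs, abs_abs]; exact abs_meanSign_le_one _ _ _)
  calc (1 / 1024 : ℝ) ≤ volume.real A * (1 / 2) := by linarith
    _ = ∫ t, A.indicator (fun _ => (1 / 2 : ℝ)) t := by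
        rw [integral_indicator_const _ hA, smul_eq_mul]
    _ ≤ _ := by
        refine integral_mono ((integrable_const _).indicator hA) hint fun t => ?_
        by_cases ht : t ∈ A
        swap
        · simp only [Set.indicator_of_notMem ht]
          exact abs_nonneg _
        simp only [Set.indicator_of_mem ht]
        obtain ⟨m, hm, hx⟩ := Set.mem_iUnion₂.1 ht
        have h1 := (rep_mem (t - ((m * α : ℝ) : UnitAddCircle))).1
        change rep (t - ((m * α : ℝ) : UnitAddCircle)) < r at hx
        set u := rep (t - ((m * α : ℝ) : UnitAddCircle)) with hu
        have ht : rep t = Int.fract (m * α + u) := by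
          rw [← rep_coe, AddCircle.coe_add, hu, coe_rep, add_sub_cancel]
        rw [ht, abs_meanSign_fract]
        refine le_trans ?_ (le_abs_meanSign α q p m u)
        have h2 : (q : ℝ) * |u| ≤ q * r := by
          rw [abs_of_nonneg h1]; exact mul_le_mul_of_nonneg_left hx.le hq0.le
        have h3 : 32 * m * |q * α - p| ≤ q * |q * α - p| :=
          mul_le_mul_of_nonneg_right (hm32 m hm) (abs_nonneg _)
        linarith

/-- If a convergent sequence with nonzero limit keeps its limit after multiplication by signs, then
the signs are eventually `1`. -/
theorem eventually_sign_eq_one {x : ℕ → ℝ} {ε : ℕ → ℤˣ} {c : ℝ} (hc : c ≠ 0)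
    (h : Tendsto x atTop (𝓝 c)) (h' : Tendsto (fun n => ((ε n : ℤ) : ℝ) * x n) atTop (𝓝 c)) :
    ∀ᶠ n in atTop, ε n = 1 := by
  have hs := h.add h'
  have h2 : ∀ᶠ n in atTop, x n + ((ε n : ℤ) : ℝ) * x n ≠ 0 :=
    hs.eventually_ne (by simpa [← two_mul] using hc)
  filter_upwards [h2] with n hn
  rcases Int.units_eq_one_or (ε n) with h | h
  · exact h
  · simp [h] at hn

/-- Almost-everywhere statements on the double cover of the circle descend to the circle. -/
theorem ae_rep_of_ae_addCircle_two {P : AddCircle (2 : ℝ) → Prop} [Fact ((0 : ℝ) < 2)]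
    (h : ∀ᵐ y : AddCircle (2 : ℝ), P y) :
    ∀ᵐ t : UnitAddCircle, P ((rep t : ℝ) : AddCircle (2 : ℝ)) := by
  have hmk : MeasurePreserving (β := AddCircle (2 : ℝ)) ((↑) : ℝ → AddCircle (2 : ℝ))
      (volume.restrict (Set.Ioc (0 : ℝ) (0 + 2))) volume := AddCircle.measurePreserving_mk 2 0
  have h1 := hmk.quasiMeasurePreserving.ae h
  have hle : volume.restrict (Set.Ioc (0 : ℝ) 1) ≤ volume.restrict (Set.Ioc (0 : ℝ) (0 + 2)) :=
    Measure.restrict_mono (Set.Ioc_subset_Ioc_right (by norm_num)) le_rfl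
  have h2 : ∀ᵐ x : ℝ ∂(volume.restrict (Set.Ioc (0 : ℝ) 1)), P (x : AddCircle (2 : ℝ)) :=
    h1.filter_mono (ae_mono hle)
  exact measurePreserving_rep.quasiMeasurePreserving.ae
    (p := fun x : ℝ => P (x : AddCircle (2 : ℝ))) h2

/-- The mean cocycle product as a function on the double cover `ℝ / 2ℤ` of the circle, to which
it descends since it is multiplied by `(-1)^q` under translation by `1`. -/
def meanSignLift (α : ℝ) (q : ℕ) (y : AddCircle (2 : ℝ)) : ℝ :=
  meanSign α q (AddCircle.measurableEquivIco (2 : ℝ) 0 (hT := ⟨two_pos⟩) y)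

theorem meanSign_add_two (α : ℝ) (q : ℕ) (t : ℝ) : meanSign α q (t + 2) = meanSign α q t := by
  rw [← one_add_one_eq_two, ← add_assoc, meanSign_add_one, meanSign_add_one, ← mul_assoc]
  rcases Int.units_eq_one_or (q : ℤ).negOnePow with h | h <;> simp [h]

theorem meanSignLift_coe (α : ℝ) (q : ℕ) (t : ℝ) :
    meanSignLift α q (t : AddCircle (2 : ℝ)) = meanSign α q t := by
  have : Fact ((0 : ℝ) < 2) := ⟨two_pos⟩
  have h : Function.Periodic (meanSign α q) 2 := meanSign_add_two α q
  have hc : ((AddCircle.measurableEquivIco (2 : ℝ) 0 (t : AddCircle (2 : ℝ)) : ℝ) :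
      AddCircle (2 : ℝ)) = (t : AddCircle (2 : ℝ)) := AddCircle.coe_equivIco
  have := congrArg h.lift hc
  rwa [Function.Periodic.lift_coe, Function.Periodic.lift_coe] at this

theorem measurable_meanSignLift (α : ℝ) (q : ℕ) : Measurable (meanSignLift α q) :=
  have : Fact ((0 : ℝ) < 2) := ⟨two_pos⟩
  ((measurable_meanSign α q).comp (measurable_subtype_coe.comp
    (AddCircle.measurableEquivIco (2 : ℝ) 0).measurable) :)

/-- Along a sequence of good coprime rational approximations of an irrational number, the mean
cocycle products diverge at almost every `t`. On the double cover the limit would be invariant under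
the ergodic rotation by `2α`, hence constant; coprimality forces the constant to be `0`, which the
lower bound for the mean absolute value excludes. -/
theorem ae_not_tendsto_meanSign {α : ℝ} (hα : Irrational α) {q : ℕ → ℕ} {p : ℕ → ℤ}
    (hq : ∀ n, 0 < q n) (hcop : ∀ n, IsCoprime (q n : ℤ) (p n))
    (happ : ∀ n, |q n * α - p n| < 1 / q n) (hlim : Tendsto q atTop atTop) :
    ∀ᵐ t : UnitAddCircle, ¬ ∃ l, Tendsto (fun n => meanSign α (q n) (rep t)) atTop (𝓝 l) := by
  have : Fact ((0 : ℝ) < 2) := ⟨two_pos⟩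
  have hδ : Tendsto (fun n => |q n * α - p n|) atTop (𝓝 0) := by
    refine squeeze_zero (fun n => abs_nonneg _) (fun n => (happ n).le) ?_
    simp_rw [one_div]
    exact tendsto_inv_atTop_zero.comp (tendsto_natCast_atTop_atTop.comp hlim)
  let f : ℕ → AddCircle (2 : ℝ) → ℝ := fun n => meanSignLift α (q n)
  have hfm : ∀ n, Measurable (f n) := fun n => measurable_meanSignLift α (q n)
  have hf1 : ∀ n y, f n (y + ((1 : ℝ) : AddCircle (2 : ℝ))) =
      (((q n : ℤ).negOnePow : ℤ) : ℝ) * f n y := by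
    intro n y
    induction y using QuotientAddGroup.induction_on with | H y => ?_
    rw [← AddCircle.coe_add]
    simp only [f, meanSignLift_coe, meanSign_add_one]
  have hfα : ∀ n y, |f n (y + (α : AddCircle (2 : ℝ))) -
      (((p n).negOnePow : ℤ) : ℝ) * f n y| ≤ 4 * |q n * α - p n| := by
    intro n y
    induction y using QuotientAddGroup.induction_on with | H y => ?_
    rw [← AddCircle.coe_add]
    simp only [f, meanSignLift_coe]
    exact abs_meanSign_add_angle_sub_le _ _ _ _
  have hf2 : ∀ y, Tendsto (fun n => f n (y + ((2 * α : ℝ) : AddCircle (2 : ℝ))) - f n y) atTop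
      (𝓝 0) := by
    intro y
    have h8 : Tendsto (fun n => 8 * |q n * α - p n|) atTop (𝓝 0) := by
      simpa using hδ.const_mul 8
    refine squeeze_zero_norm (fun n => ?_) h8
    have h1 := hfα n y
    have h2 := hfα n (y + (α : AddCircle (2 : ℝ)))
    rw [add_assoc, ← AddCircle.coe_add, ← two_mul] at h2
    rw [Real.norm_eq_abs]
    rcases Int.units_eq_one_or (p n).negOnePow with h | h <;> rw [h] at h1 h2 <;>
      push_cast at h1 h2 <;> rw [abs_le] at h1 h2 ⊢ <;> constructor <;> linarith
  have hergo : Ergodic (· + ((2 * α : ℝ) : AddCircle (2 : ℝ))) := by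
    rw [AddCircle.ergodic_add_right, ← AddCircle.denseRange_zsmul_iff,
      AddCircle.denseRange_zsmul_coe_iff]
    simpa using hα
  have hCm : MeasurableSet {y | ∃ l, Tendsto (fun n => f n y) atTop (𝓝 l)} :=
    measurableSet_exists_tendsto hfm
  have hiff : ∀ y l, Tendsto (fun n => f n (y + ((2 * α : ℝ) : AddCircle (2 : ℝ)))) atTop (𝓝 l) ↔
      Tendsto (fun n => f n y) atTop (𝓝 l) := by
    intro y l
    constructor <;> intro h
    · simpa using h.sub (hf2 y)
    · simpa using h.add (hf2 y)
  have hCi : (· + ((2 * α : ℝ) : AddCircle (2 : ℝ))) ⁻¹'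
      {y | ∃ l, Tendsto (fun n => f n y) atTop (𝓝 l)} =
      {y | ∃ l, Tendsto (fun n => f n y) atTop (𝓝 l)} := by
    ext y
    simp only [Set.mem_preimage, Set.mem_ofPred_eq, hiff]
  rcases hergo.ae_mem_or_ae_notMem hCm hCi with hC | hC
  swap
  · filter_upwards [ae_rep_of_ae_addCircle_two hC] with t ht
    simpa only [Set.mem_ofPred_eq, f, meanSignLift_coe] using ht
  exfalso
  obtain ⟨D, hDm, hD⟩ := measurable_limit_of_tendsto_metrizable_ae
    (fun n => (hfm n).aemeasurable) hC
  have hDinv : D ∘ (· + ((2 * α : ℝ) : AddCircle (2 : ℝ))) =ᵐ[volume] D := by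
    filter_upwards [hD, hergo.quasiMeasurePreserving.ae hD] with y h1 h2
    exact tendsto_nhds_unique h2 ((hiff y _).2 h1)
  obtain ⟨c, hc⟩ := hergo.ae_eq_const_of_ae_eq_comp_ae hDm.aestronglyMeasurable hDinv
  have hlimc : ∀ᵐ y, Tendsto (fun n => f n y) atTop (𝓝 c) := by
    filter_upwards [hD, hc] with y h1 h2
    rwa [h2] at h1
  -- if `c ≠ 0`, comparing the limits at `y`, `y + 1` and `y + α` makes `q n` and `p n` both even
  have hc0 : c = 0 := by
    by_contra hne
    have htr : ∀ a : AddCircle (2 : ℝ), ∀ᵐ y, Tendsto (fun n => f n (y + a)) atTop (𝓝 c) :=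
      fun a => (measurePreserving_add_right volume a).quasiMeasurePreserving.ae
        (p := fun y => Tendsto (fun n => f n y) atTop (𝓝 c)) hlimc
    obtain ⟨y, hy, hy1, hyα⟩ := (hlimc.and ((htr ((1 : ℝ) : AddCircle (2 : ℝ))).and
      (htr (α : AddCircle (2 : ℝ))))).exists
    have hα' : Tendsto (fun n => (((p n).negOnePow : ℤ) : ℝ) * f n y) atTop (𝓝 c) := by
      have h4 : Tendsto (fun n => f n (y + (α : AddCircle (2 : ℝ))) -
          (((p n).negOnePow : ℤ) : ℝ) * f n y) atTop (𝓝 0) :=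
        squeeze_zero_norm (fun n => hfα n y) (by simpa using hδ.const_mul 4)
      simpa using hyα.sub h4
    simp_rw [hf1] at hy1
    obtain ⟨n, h1, h2⟩ := ((eventually_sign_eq_one hne hy hy1).and
      (eventually_sign_eq_one hne hy hα')).exists
    rw [Int.negOnePow_eq_one_iff] at h1 h2
    have := (hcop n).isUnit_of_dvd' h1.two_dvd h2.two_dvd
    norm_num [Int.isUnit_iff] at this
  -- the limit `0` contradicts the lower bound for the mean of the absolute value
  have hz : ∀ᵐ t : UnitAddCircle, Tendsto (fun n => |meanSign α (q n) (rep t)|) atTop (𝓝 0) := by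
    filter_upwards [ae_rep_of_ae_addCircle_two hlimc] with t ht
    simp only [f, meanSignLift_coe, hc0] at ht
    simpa using ht.abs
  have hint : Tendsto (fun n => ∫ t : UnitAddCircle, |meanSign α (q n) (rep t)|) atTop
      (𝓝 (∫ t : UnitAddCircle, (0 : ℝ))) := by
    refine tendsto_integral_of_dominated_convergence (fun _ => 1)
      (fun n => ((measurable_meanSign α (q n)).comp measurable_rep).norm.aestronglyMeasurable)
      (integrable_const _) (fun n => Eventually.of_forall fun t => ?_) hz
    rw [Real.norm_eq_abs, abs_abs]
    exact abs_meanSign_le_one _ _ _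
  have := ge_of_tendsto' hint fun n => le_integral_abs_meanSign (hq n) (hcop n) (happ n)
  simp at this
  norm_num at this

/-- An irrational number has good coprime rational approximations with denominators tending to
infinity. -/
theorem exists_approximation {α : ℝ} (hα : Irrational α) :
    ∃ (q : ℕ → ℕ) (p : ℕ → ℤ), (∀ n, 0 < q n) ∧ (∀ n, IsCoprime (q n : ℤ) (p n)) ∧
      (∀ n, |q n * α - p n| < 1 / q n) ∧ Tendsto q atTop atTop := by
  have hinf := Real.infinite_rat_abs_sub_lt_one_div_den_sq_of_irrational hα
  have hunb : ∀ N : ℕ, ∃ r : ℚ, |α - r| < 1 / (r.den : ℝ) ^ 2 ∧ N < r.den := by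
    intro N
    by_contra! h
    refine hinf ((Set.Finite.biUnion (Set.finite_Iic N) fun d _ =>
      (Set.finite_Icc (⌊α * d⌋ - 1) (⌈α * d⌉ + 1)).image fun k : ℤ => (k : ℚ) / d).subset ?_)
    intro r hr
    simp only [Set.mem_iUnion]
    refine ⟨r.den, h r hr, r.num, ?_, Rat.num_div_den r⟩
    have hd : (1 : ℝ) ≤ r.den := by exact_mod_cast r.den_pos
    have h1 : |α * r.den - r.num| ≤ 1 := by
      have e : α * r.den - r.num = (α - r) * r.den := by
        rw [Rat.cast_def]; field_simp
      rw [e, abs_mul, abs_of_pos (zero_lt_one.trans_le hd)]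
      have h2 : |α - r| < 1 / (r.den : ℝ) ^ 2 := hr
      rw [lt_div_iff₀ (by positivity)] at h2
      nlinarith [abs_nonneg (α - r)]
    rw [abs_le] at h1
    have h3 := Int.floor_le (α * r.den)
    have h4 := Int.le_ceil (α * r.den)
    constructor
    · have : ((⌊α * r.den⌋ - 1 : ℤ) : ℝ) ≤ (r.num : ℝ) := by push_cast; linarith
      exact_mod_cast this
    · have : (r.num : ℝ) ≤ ((⌈α * r.den⌉ + 1 : ℤ) : ℝ) := by push_cast; linarith
      exact_mod_cast this
  choose r hr hN using hunb
  refine ⟨fun n => (r n).den, fun n => (r n).num, fun n => (r n).den_pos, fun n => ?_,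
    fun n => ?_, tendsto_atTop_mono (fun n => (hN n).le) tendsto_id⟩
  · rw [Int.isCoprime_iff_gcd_eq_one, Int.gcd_comm]
    simpa [Int.gcd] using (r n).reduced
  · have hd : (0 : ℝ) < (r n).den := by exact_mod_cast (r n).den_pos
    have e : ((r n).den : ℝ) * α - (r n).num = (r n).den * (α - r n) := by
      rw [Rat.cast_def]; field_simp
    rw [e, abs_mul, abs_of_pos hd, lt_div_iff₀ hd]
    have := hr n
    rw [lt_div_iff₀ (by positivity)] at this
    nlinarith

/-! ### Decorrelation on the circle -/

theorem zsmul_coe_ne_zero {α : ℝ} (hα : Irrational α) {k : ℤ} (hk : k ≠ 0) :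
    k • (α : UnitAddCircle) ≠ 0 := by
  intro h
  rw [← AddCircle.coe_zsmul, AddCircle.coe_eq_zero_iff] at h
  obtain ⟨n, hn⟩ := h
  rw [zsmul_eq_mul, zsmul_eq_mul, mul_one] at hn
  exact (hα.intCast_mul hk).ne_int n hn.symm

theorem ergodic_rotation {α : ℝ} (hα : Irrational α) :
    Ergodic (· + (α : UnitAddCircle)) := by
  rw [AddCircle.ergodic_add_right, ← AddCircle.denseRange_zsmul_iff,
    AddCircle.denseRange_zsmul_coe_iff, div_one]
  exact hα

theorem norm_integral_mul_le {f F : UnitAddCircle → ℂ} {C : ℝ} (hf : ∀ s, ‖f s‖ ≤ C)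
    (hF : Integrable F volume) : ‖∫ s, f s * F s‖ ≤ C * ∫ s, ‖F s‖ := by
  rw [← integral_const_mul]
  refine norm_integral_le_of_norm_le (hF.norm.const_mul C) (Eventually.of_forall fun s => ?_)
  rw [norm_mul]
  exact mul_le_mul_of_nonneg_right (hf s) (norm_nonneg _)

/-- Uniformly bounded functions that become invariant under an irrational rotation become
uncorrelated to each character of the circle. -/
theorem tendsto_integral_mul_fourier {α : ℝ} (hα : Irrational α) {f : ℕ → UnitAddCircle → ℂ}
    (hfm : ∀ n, Measurable (f n)) (hfb : ∀ n s, ‖f n s‖ ≤ 2) (hmean : ∀ n, ∫ s, f n s = 0)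
    (hinv : Tendsto (fun n => ∫ s, ‖f n (s + (α : UnitAddCircle)) - f n s‖) atTop (𝓝 0))
    (k : ℤ) : Tendsto (fun n => ∫ s, f n s * fourier k s) atTop (𝓝 0) := by
  have hfi : ∀ n, Integrable (f n) volume := fun n =>
    .of_bound (hfm n).aestronglyMeasurable 2 (Eventually.of_forall (hfb n))
  have hkn : ∀ s : UnitAddCircle, ‖fourier k s‖ = 1 := fun s => by
    rw [fourier_apply, Circle.norm_coe]
  have hki : ∀ {g : UnitAddCircle → ℂ}, Integrable g volume →
      Integrable (fun s => g s * fourier k s) volume := fun hg =>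
    hg.mul_bdd (c := 1) (fourier k).continuous.aestronglyMeasurable
      (Eventually.of_forall fun s => (hkn s).le)
  by_cases hk : k = 0
  · simp [hk, hmean]
  set c : ℂ := fourier k (α : UnitAddCircle) with hc
  have hc0 : c ≠ 0 := norm_ne_zero_iff.1 (by rw [hkn]; exact one_ne_zero)
  have hc1 : c⁻¹ - 1 ≠ 0 := by
    rw [sub_ne_zero, ne_eq, inv_eq_one, hc, fourier_apply, ← Circle.coe_one, Circle.coe_inj,
      ← AddCircle.toCircle_zero (T := 1)]
    exact fun h => zsmul_coe_ne_zero hα hk (AddCircle.injective_toCircle one_ne_zero h)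
  have hadd : ∀ s, fourier k (s + (α : UnitAddCircle)) = fourier k s * c := fun s => by
    rw [hc, fourier_apply, fourier_apply, fourier_apply, smul_add, AddCircle.toCircle_add,
      Circle.coe_mul]
  have key : ∀ n, (∫ s, f n s * fourier k s) =
      (c⁻¹ - 1)⁻¹ * ∫ s, (f n (s + (α : UnitAddCircle)) - f n s) * fourier k s := by
    intro n
    have h1 : ∫ s, f n (s + (α : UnitAddCircle)) * fourier k s =
        c⁻¹ * ∫ s, f n s * fourier k s := by
      rw [← integral_add_right_eq_self (fun s => f n s * fourier k s) (α : UnitAddCircle),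
        ← integral_const_mul]
      refine integral_congr_ae (Eventually.of_forall fun s => ?_)
      simp only [hadd]
      field_simp
    have h2 : ∫ s, (f n (s + (α : UnitAddCircle)) - f n s) * fourier k s =
        (c⁻¹ - 1) * ∫ s, f n s * fourier k s := by
      simp_rw [sub_mul]
      rw [integral_sub (hki ((hfi n).comp_add_right _)) (hki (hfi n)), h1]
      ring
    rw [h2, inv_mul_cancel_left₀ hc1]
  have hz : Tendsto (fun n => ∫ s, (f n (s + (α : UnitAddCircle)) - f n s) * fourier k s) atTop
      (𝓝 0) := by
    refine squeeze_zero_norm (fun n => ?_) hinv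
    refine (norm_integral_le_integral_norm _).trans_eq ?_
    simp_rw [norm_mul, hkn, mul_one]
  simp_rw [key]
  simpa using hz.const_mul (c⁻¹ - 1)⁻¹

/-- Uniformly bounded functions that become invariant under an irrational rotation become
uncorrelated to each integrable function. -/
theorem tendsto_integral_mul_of_integrable {α : ℝ} (hα : Irrational α)
    {f : ℕ → UnitAddCircle → ℂ}
    (hfm : ∀ n, Measurable (f n)) (hfb : ∀ n s, ‖f n s‖ ≤ 2) (hmean : ∀ n, ∫ s, f n s = 0)
    (hinv : Tendsto (fun n => ∫ s, ‖f n (s + (α : UnitAddCircle)) - f n s‖) atTop (𝓝 0))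
    {F : UnitAddCircle → ℂ} (hF : Integrable F volume) :
    Tendsto (fun n => ∫ s, f n s * F s) atTop (𝓝 0) := by
  have hv : (AddCircle.haarAddCircle : Measure UnitAddCircle) = volume := by
    rw [AddCircle.volume_eq_smul_haarAddCircle, ENNReal.ofReal_one, one_smul]
  have hae : ∀ {P : UnitAddCircle → Prop},
      (∀ᵐ s ∂(AddCircle.haarAddCircle : Measure UnitAddCircle), P s) → ∀ᵐ s, P s := by
    rw [hv]; exact id
  have hi : ∀ {G : UnitAddCircle → ℂ}, Integrable G AddCircle.haarAddCircle →
      Integrable G volume := by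
    rw [hv]; exact id
  have hmul : ∀ (n : ℕ) {G : UnitAddCircle → ℂ}, Integrable G volume →
      Integrable (fun s => f n s * G s) volume := fun n G hG =>
    hG.bdd_mul (c := 2) (hfm n).aestronglyMeasurable (Eventually.of_forall (hfb n))
  have hint : ∀ G : Lp ℂ 1 (AddCircle.haarAddCircle : Measure UnitAddCircle),
      Integrable G volume := fun G =>
    hi (L1.integrable_coeFn G)
  -- the functions that become uncorrelated form a closed subspace containing the characters
  have hspan : ∀ G ∈ Submodule.span ℂ (Set.range (fourierLp (T := 1) 1)),
      Tendsto (fun n => ∫ s, f n s * G s) atTop (𝓝 0) := by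
    intro G hG
    induction hG using Submodule.span_induction with
    | mem G hG =>
      obtain ⟨k, rfl⟩ := hG
      refine (tendsto_integral_mul_fourier hα hfm hfb hmean hinv k).congr fun n => ?_
      have h := coeFn_fourierLp (T := 1) 1 k
      refine integral_congr_ae ?_
      filter_upwards [hae h] with s hs
      rw [hs]
    | zero =>
      refine tendsto_const_nhds.congr fun n => ?_
      have h := Lp.coeFn_zero ℂ 1 (AddCircle.haarAddCircle : Measure UnitAddCircle)
      rw [← integral_zero UnitAddCircle ℂ (μ := volume)]
      refine integral_congr_ae ?_
      filter_upwards [hae h] with s hs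
      rw [hs, Pi.zero_apply, mul_zero]
    | add G H _ _ hG hH =>
      have h0 := hG.add hH
      rw [add_zero] at h0
      refine h0.congr fun n => ?_
      have h := Lp.coeFn_add G H
      rw [← integral_add (hmul n (hint G)) (hmul n (hint H))]
      refine integral_congr_ae ?_
      filter_upwards [hae h] with s hs
      rw [hs, Pi.add_apply, mul_add]
    | smul c G _ hG =>
      have h0 := hG.const_mul c
      rw [mul_zero] at h0
      refine h0.congr fun n => ?_
      have h := Lp.coeFn_smul c G
      rw [← integral_const_mul]
      refine integral_congr_ae ?_
      filter_upwards [hae h] with s hs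
      rw [hs, Pi.smul_apply, smul_eq_mul, mul_left_comm]
  have hF' : Integrable F AddCircle.haarAddCircle := by rwa [hv]
  have hcl : hF'.toL1 F ∈ closure
      (Submodule.span ℂ (Set.range (fourierLp (T := 1) 1)) : Set (Lp ℂ 1 _)) := by
    rw [← Submodule.topologicalClosure_coe, span_fourierLp_closure_eq_top ENNReal.one_ne_top]
    trivial
  rw [Metric.tendsto_atTop]
  intro ε hε
  obtain ⟨G, hG, hdist⟩ := Metric.mem_closure_iff.1 hcl (ε / 4) (by positivity)
  have hGF : ∫ s, ‖F s - G s‖ < ε / 4 := by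
    rw [dist_eq_norm, L1.norm_eq_integral_norm,
      show ∀ g : UnitAddCircle → ℝ, ∫ s, g s ∂AddCircle.haarAddCircle = ∫ s, g s by
        rw [hv]; exact fun _ => rfl] at hdist
    refine lt_of_eq_of_lt (integral_congr_ae ?_) hdist
    have h1 := Lp.coeFn_sub (hF'.toL1 F) G
    have h2 := hF'.coeFn_toL1
    filter_upwards [hae h1, hae h2] with s hs1 hs2
    rw [hs1, Pi.sub_apply, hs2]
  obtain ⟨N, hN⟩ := Metric.tendsto_atTop.1 (hspan G hG) (ε / 2) (by positivity)
  refine ⟨N, fun n hn => ?_⟩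
  have h1 := hN n hn
  rw [dist_zero_right] at h1 ⊢
  have h2 := norm_integral_mul_le (hfb n) (hF.sub (hint G))
  have h3 : ∫ s, f n s * F s =
      (∫ s, f n s * (F - G) s) + ∫ s, f n s * G s := by
    rw [← integral_add (hmul n (hF.sub (hint G))) (hmul n (hint G))]
    refine integral_congr_ae (Eventually.of_forall fun s => ?_)
    simp only [Pi.sub_apply]
    ring
  rw [h3]
  refine (norm_add_le _ _).trans_lt ?_
  simp only [Pi.sub_apply] at h2 ⊢
  linarith

/-! ### Conditional expectations and weak compactness -/

/-- The conditional expectation of a bounded function given `X`, as a bounded measurable function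
of the value of `X` that is defined everywhere. -/
theorem exists_condExp_factor {Ω E : Type*} [MeasurableSpace Ω] [MeasurableSpace E]
    (P : Measure Ω) [IsProbabilityMeasure P] {X : Ω → E} (hX : Measurable X) {h : Ω → ℂ}
    (hh : Measurable h) {C : ℝ} (hC : 0 ≤ C) (hb : ∀ ω, ‖h ω‖ ≤ C) :
    ∃ H : E → ℂ, Measurable H ∧ (∀ e, ‖H e‖ ≤ C) ∧
      ∀ (a : E → ℂ) (D : ℝ), Measurable a → (∀ e, ‖a e‖ ≤ D) →
        ∫ ω, a (X ω) * h ω ∂P = ∫ e, a e * H e ∂(P.map X) := by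
  classical
  -- truncation makes the conditional mean bounded for every value of `X`
  let T : ℂ → ℂ := fun z => if ‖z‖ ≤ C then z else 0
  have hT : Measurable T := Measurable.ite (measurableSet_le measurable_norm measurable_const)
    measurable_id measurable_const
  have hTb : ∀ z, ‖T z‖ ≤ C := fun z => by
    by_cases hz : ‖z‖ ≤ C <;> simp [T, hz, hC]
  have hTh : ∀ ω, T (h ω) = h ω := fun ω => if_pos (hb ω)
  refine ⟨fun e => ∫ z, T z ∂(ProbabilityTheory.condDistrib h X P e), ?_, fun e => ?_,
    fun a D ha hD => ?_⟩
  · exact ((hT.comp measurable_snd).stronglyMeasurable.integral_condDistrib).measurable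
  · simpa using norm_integral_le_of_norm_le_const
      (μ := ProbabilityTheory.condDistrib h X P e) (Eventually.of_forall hTb)
  · have hm : Measurable fun p : E × ℂ => a p.1 * T p.2 :=
      (ha.comp measurable_fst).mul (hT.comp measurable_snd)
    have hXh : Measurable fun ω => (X ω, h ω) := hX.prodMk hh
    have : IsProbabilityMeasure (P.map X) := Measure.isProbabilityMeasure_map hX.aemeasurable
    calc ∫ ω, a (X ω) * h ω ∂P = ∫ ω, a (X ω) * T (h ω) ∂P := by simp_rw [hTh]
      _ = ∫ p, a p.1 * T p.2 ∂(P.map fun ω => (X ω, h ω)) :=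
          (integral_map hXh.aemeasurable hm.aestronglyMeasurable).symm
      _ = ∫ p, a p.1 * T p.2 ∂((P.map X).compProd (ProbabilityTheory.condDistrib h X P)) := by
          rw [ProbabilityTheory.compProd_map_condDistrib hh.aemeasurable]
      _ = ∫ e, ∫ z, a e * T z ∂(ProbabilityTheory.condDistrib h X P e) ∂(P.map X) := by
          refine Measure.integral_compProd (.of_bound hm.aestronglyMeasurable (D * C)
            (Eventually.of_forall fun p => ?_))
          rw [norm_mul]
          exact mul_le_mul (hD _) (hTb _) (norm_nonneg _) ((norm_nonneg _).trans (hD p.1))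
      _ = _ := by simp_rw [integral_const_mul]

/-- An invariant function on one factor is independent of an ergodic factor. -/
theorem map_prodMk_eq_prod_of_ergodic {Ω E Y : Type*} [MeasurableSpace Ω] [MeasurableSpace E]
    [MeasurableSpace Y] {ξ : Measure Ω} [IsProbabilityMeasure ξ] {S : Ω → Ω} {R : Y → Y}
    (hS : MeasurePreserving S ξ ξ) {τ : Ω → E} (hτ : Measurable τ) (hτS : τ ∘ S = τ)
    {π : Ω → Y} (hπ : Measurable π) (hπS : Function.Semiconj π S R) (hR : Ergodic R (ξ.map π)) :
    ξ.map (fun ω => (τ ω, π ω)) = (ξ.map τ).prod (ξ.map π) := by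
  have : IsProbabilityMeasure (ξ.map π) := Measure.isProbabilityMeasure_map hπ.aemeasurable
  have : IsProbabilityMeasure (ξ.map τ) := Measure.isProbabilityMeasure_map hτ.aemeasurable
  refine (Measure.prod_eq fun A B hA hB => ?_).symm
  rw [Measure.map_apply (hτ.prodMk hπ) (hA.prod hB), Measure.map_apply hτ hA]
  have hinv : MeasurePreserving S (ξ.restrict (τ ⁻¹' A)) (ξ.restrict (τ ⁻¹' A)) := by
    have h := hS.restrict_preimage (hτ hA)
    rwa [← Set.preimage_comp, hτS] at h
  have hpres : MeasurePreserving R ((ξ.restrict (τ ⁻¹' A)).map π)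
      ((ξ.restrict (τ ⁻¹' A)).map π) :=
    (hπ.measurePreserving _).of_semiconj hinv hπS hR.measurable
  have hac : (ξ.restrict (τ ⁻¹' A)).map π ≪ ξ.map π :=
    Measure.restrict_le_self.absolutelyContinuous.map hπ
  obtain ⟨c, hc⟩ := hR.eq_smul_of_absolutelyContinuous hpres hac
  have huniv := congrArg (fun ρ => ρ Set.univ) hc
  simp only [Measure.smul_apply, measure_univ, Measure.map_apply hπ MeasurableSet.univ,
    Set.preimage_univ, Measure.restrict_apply_univ] at huniv
  have hB' := congrArg (fun ρ => ρ B) hc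
  simp only [Measure.smul_apply] at hB'
  rw [Measure.map_apply hπ hB, Measure.restrict_apply (hπ hB)] at hB'
  rw [Set.mk_preimage_prod, Set.inter_comm, hB', huniv]
  simp

/-- A uniformly bounded sequence of functions on a probability space has a weakly convergent
subsequence. -/
theorem exists_subseq_tendsto_integral_mul {Y : Type*} [MeasurableSpace Y]
    [MeasurableSpace.CountablyGenerated Y] (ν : Measure Y) [IsProbabilityMeasure ν]
    {g : ℕ → Y → ℂ} (hg : ∀ n, Measurable (g n)) {C : ℝ} (hC : ∀ n y, ‖g n y‖ ≤ C) :
    ∃ φ : ℕ → ℕ, StrictMono φ ∧ ∀ (k : Y → ℂ) (D : ℝ), Measurable k → (∀ y, ‖k y‖ ≤ D) →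
      ∃ l, Tendsto (fun n => ∫ y, k y * g (φ n) y ∂ν) atTop (𝓝 l) := by
  have hfact : Fact ((2 : ℝ≥0∞) ≠ ∞) := ⟨ENNReal.ofNat_ne_top⟩
  have hmem : ∀ n, MemLp (fun y => conj (g n y)) 2 ν := fun n =>
    .of_bound (Complex.continuous_conj.measurable.comp (hg n)).aestronglyMeasurable C
      (Eventually.of_forall fun y => by rw [RCLike.norm_conj]; exact hC n y)
  have hball : ∀ n, StrongDual.toWeakDual (innerSL ℂ ((hmem n).toLp _)) ∈
      WeakDual.toStrongDual ⁻¹' Metric.closedBall (0 : StrongDual ℂ (Lp ℂ 2 ν)) C := by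
    intro n
    have h0 : (0 : ℝ) ≤ C := by
      obtain ⟨y⟩ : Nonempty Y := nonempty_of_isProbabilityMeasure ν
      exact (norm_nonneg _).trans (hC n y)
    simp only [Set.mem_preimage, mem_closedBall_zero_iff]
    change ‖innerSL ℂ ((hmem n).toLp _)‖ ≤ C
    rw [innerSL_apply_norm]
    have h := Lp.norm_le_of_ae_bound (f := (hmem n).toLp _) h0 (by
      filter_upwards [(hmem n).coeFn_toLp] with y hy
      rw [hy, RCLike.norm_conj]
      exact hC n y)
    have h1 : measureUnivNNReal ν = 1 := by simp [measureUnivNNReal]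
    simpa [h1] using h
  obtain ⟨L, -, φ, hφ, hL⟩ := WeakDual.isSeqCompact_closedBall ℂ (Lp ℂ 2 ν) 0 C hball
  refine ⟨φ, hφ, fun k D hk hD => ?_⟩
  have hkm : MemLp k 2 ν := .of_bound hk.aestronglyMeasurable D (Eventually.of_forall hD)
  refine ⟨L (hkm.toLp k), ?_⟩
  refine (((WeakDual.eval_continuous (hkm.toLp k)).tendsto L).comp hL).congr fun n => ?_
  change inner ℂ ((hmem (φ n)).toLp _) (hkm.toLp k) = _
  rw [L2.inner_def]
  refine integral_congr_ae ?_
  filter_upwards [(hmem (φ n)).coeFn_toLp, hkm.coeFn_toLp] with y h1 h2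
  rw [h1, h2, RCLike.inner_apply, RCLike.conj_conj]

/-! ### Invariant couplings of the skew product with an ergodic system -/

theorem iterate_skewProduct (α : ℝ) (n : ℕ) (t s : UnitAddCircle) (κ : ℤˣ) :
    (skewProduct α)^[n] (t, s, κ) =
      (t, s + n • (α : UnitAddCircle), κ * cocycleProd α n t s) := by
  induction n with
  | zero => simp [cocycleProd]
  | succ n ih =>
    have h : cocycleProd α (n + 1) t s =
        cocycleProd α n t s * cocycle t (s + n • (α : UnitAddCircle)) :=
      Finset.prod_range_succ _ _
    rw [Function.iterate_succ_apply', ih, h]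
    simp [skewProduct, add_smul, add_assoc, mul_assoc]

/-- The cocycle product over the last `n` steps before arriving at `s`. -/
def pastProd (α : ℝ) (n : ℕ) (t s : UnitAddCircle) : ℂ :=
  ((cocycleProd α n t (s - n • (α : UnitAddCircle)) : ℤ) : ℂ)

theorem measurable_sign_cast : Measurable fun u : ℤˣ => ((u : ℤ) : ℂ) :=
  measurable_of_countable _

theorem norm_sign_cast (u : ℤˣ) : ‖((u : ℤ) : ℂ)‖ = 1 := by
  rcases Int.units_eq_one_or u with rfl | rfl <;> simp

theorem measurable_pastProd (α : ℝ) (n : ℕ) :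
    Measurable fun p : UnitAddCircle × UnitAddCircle => pastProd α n p.1 p.2 := by
  unfold pastProd
  exact (measurable_sign_cast.comp ((measurable_cocycleProd α n).comp
    (measurable_fst.prodMk (measurable_snd.sub_const _))) :)

theorem norm_pastProd (α : ℝ) (n : ℕ) (t s : UnitAddCircle) : ‖pastProd α n t s‖ = 1 :=
  norm_sign_cast _

theorem integral_pastProd (α : ℝ) (n : ℕ) (t : UnitAddCircle) :
    ∫ s, pastProd α n t s = (meanSign α n (rep t) : ℂ) := by
  unfold pastProd
  rw [integral_sub_right_eq_self (fun s => ((cocycleProd α n t s : ℤ) : ℂ)),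
    ← integral_cocycleProd, ← integral_complex_ofReal]
  push_cast
  rfl

theorem integral_norm_pastProd_add_angle_sub_le (α : ℝ) (q : ℕ) (p : ℤ) (t : UnitAddCircle) :
    ∫ s, ‖pastProd α q t (s + (α : UnitAddCircle)) - pastProd α q t s‖ ≤ 8 * |q * α - p| := by
  refine le_of_eq_of_le ?_ (integral_abs_cocycleProd_add_angle_sub_le α q p t)
  rw [← integral_sub_right_eq_self (fun s => |((cocycleProd α q t (s + α) : ℤ) : ℝ) -
    ((cocycleProd α q t s : ℤ) : ℝ)|) (q • (α : UnitAddCircle))]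
  refine integral_congr_ae (Eventually.of_forall fun s => ?_)
  simp only [pastProd]
  rw [add_sub_right_comm, ← Real.norm_eq_abs, ← Complex.norm_real]
  push_cast
  rfl

/-- Along good rational approximations, the products over the past become uncorrelated, as functions
of `s`, to every integrable function, up to their mean. -/
theorem tendsto_integral_pastProd_mul_sub {α : ℝ} (hα : Irrational α) {q : ℕ → ℕ} {p : ℕ → ℤ}
    (hδ : Tendsto (fun n => |q n * α - p n|) atTop (𝓝 0)) (t : UnitAddCircle)
    {F : UnitAddCircle → ℂ} (hF : Integrable F volume) :
    Tendsto (fun n => (∫ s, pastProd α (q n) t s * F s) -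
      (meanSign α (q n) (rep t) : ℂ) * ∫ s, F s) atTop (𝓝 0) := by
  have hm : ∀ n, Measurable (pastProd α n t) := fun n =>
    ((measurable_pastProd α n).comp (measurable_const.prodMk measurable_id) :)
  have hi : ∀ n, Integrable (pastProd α n t) volume := fun n =>
    .of_bound (hm n).aestronglyMeasurable 1
      (Eventually.of_forall fun s => (norm_pastProd _ _ _ _).le)
  have h := tendsto_integral_mul_of_integrable hα
    (f := fun n s => pastProd α (q n) t s - (meanSign α (q n) (rep t) : ℂ))
    (fun n => (hm _).sub_const _) (fun n s => ?_) (fun n => ?_) ?_ hF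
  · refine h.congr fun n => ?_
    simp_rw [sub_mul]
    rw [integral_sub _ (hF.const_mul _), integral_const_mul]
    exact hF.bdd_mul (c := 1) (hm _).aestronglyMeasurable
      (Eventually.of_forall fun s => (norm_pastProd _ _ _ _).le)
  · refine (norm_sub_le _ _).trans ?_
    rw [norm_pastProd, Complex.norm_real, Real.norm_eq_abs]
    linarith [abs_meanSign_le_one α (q n) (rep t)]
  · rw [integral_sub (hi _) (integrable_const _), integral_pastProd]
    simp
  · simp only [sub_sub_sub_cancel_right]
    refine squeeze_zero (fun n => integral_nonneg fun s => norm_nonneg _)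
      (fun n => integral_norm_pastProd_add_angle_sub_le α (q n) (p n) t) ?_
    simpa using hδ.const_mul 8

/-- If the product of a real sequence and a nonzero complex number converges, so does the
sequence. -/
theorem exists_tendsto_of_tendsto_ofReal_mul {x : ℕ → ℝ} {c l : ℂ} (hc : c ≠ 0)
    (h : Tendsto (fun n => (x n : ℂ) * c) atTop (𝓝 l)) : ∃ r, Tendsto x atTop (𝓝 r) := by
  have h1 := (Complex.continuous_re.tendsto _).comp (h.mul_const c⁻¹)
  refine ⟨_, h1.congr fun n => ?_⟩
  simp [mul_assoc, mul_inv_cancel₀ hc]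

/-- In a coupling of the skew product with an ergodic system, invariant under the product map, the
sign coordinate is uncorrelated to the ergodic system. -/
theorem integral_sign_mul_eq_zero {α : ℝ} (hα : Irrational α) {Y : Type*} [MeasurableSpace Y]
    [MeasurableSpace.CountablyGenerated Y] {R : Y → Y}
    {ξ : Measure ((UnitAddCircle × UnitAddCircle × ℤˣ) × Y)} [IsProbabilityMeasure ξ]
    (hts : ξ.map (fun w => (w.1.1, w.1.2.1)) = volume.prod volume)
    (hinv : MeasurePreserving (Prod.map (skewProduct α) R) ξ ξ)
    (hR : Ergodic R (ξ.map Prod.snd)) {g : Y → ℂ} (hg : Measurable g) {C : ℝ}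
    (hC : ∀ y, ‖g y‖ ≤ C) : ∫ w, ((w.1.2.2 : ℤ) : ℂ) * g w.2 ∂ξ = 0 := by
  obtain ⟨q, p, hq, hcop, happ, hlim⟩ := exists_approximation hα
  set ν := ξ.map Prod.snd with hν
  have : IsProbabilityMeasure ν := Measure.isProbabilityMeasure_map measurable_snd.aemeasurable
  have hC0 : 0 ≤ C := by
    obtain ⟨y⟩ : Nonempty Y := nonempty_of_isProbabilityMeasure ν
    exact (norm_nonneg _).trans (hC y)
  have hgR : ∀ n, Measurable fun y => g (R^[n] y) := fun n => hg.comp (hR.measurable.iterate n)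
  have hκm : Measurable fun w : (UnitAddCircle × UnitAddCircle × ℤˣ) × Y =>
      ((w.1.2.2 : ℤ) : ℂ) :=
    measurable_sign_cast.comp (measurable_snd.comp (measurable_snd.comp measurable_fst))
  have htm : Measurable fun w : (UnitAddCircle × UnitAddCircle × ℤˣ) × Y => w.1.1 :=
    measurable_fst.comp measurable_fst
  have hsm : Measurable fun w : (UnitAddCircle × UnitAddCircle × ℤˣ) × Y => w.1.2.1 :=
    measurable_fst.comp (measurable_snd.comp measurable_fst)
  have ht : ξ.map (fun w => w.1.1) = volume := by
    have h := congrArg (Measure.map Prod.fst) hts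
    rw [Measure.map_map measurable_fst (htm.prodMk hsm), Measure.map_fst_prod, measure_univ,
      one_smul] at h
    exact h
  -- the parameter `t` is invariant, hence independent of the ergodic factor
  have hty : ξ.map (fun w => (w.1.1, w.2)) = volume.prod ν := by
    rw [← ht]
    exact map_prodMk_eq_prod_of_ergodic hinv htm rfl measurable_snd (fun _ => rfl) hR
  obtain ⟨k, hkm, hkb, hk⟩ := exists_condExp_factor ξ (htm.prodMk measurable_snd) hκm zero_le_one
    fun w => (norm_sign_cast _).le
  obtain ⟨F, hFm, hFb, hF⟩ := exists_condExp_factor ξ (htm.prodMk hsm)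
    (h := fun w => ((w.1.2.2 : ℤ) : ℂ) * g w.2) (hκm.mul (hg.comp measurable_snd)) hC0 fun w => by
      rw [norm_mul, norm_sign_cast, one_mul]; exact hC _
  rw [hty] at hk
  rw [hts] at hF
  have hFi : ∀ t, Integrable (fun s => F (t, s)) volume := fun t =>
    .of_bound (hFm.comp (measurable_const.prodMk measurable_id)).aestronglyMeasurable C
      (Eventually.of_forall fun s => hFb _)
  let u : ℕ → UnitAddCircle → ℂ := fun n t => ∫ y, k (t, y) * g (R^[n] y) ∂ν
  let v : ℕ → UnitAddCircle → ℂ := fun n t => ∫ s, pastProd α n t s * F (t, s)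
  have hum : ∀ n, Measurable fun e : UnitAddCircle × Y => k e * g (R^[n] e.2) := fun n =>
    hkm.mul ((hgR n).comp measurable_snd)
  have hub : ∀ n e, ‖k e * g (R^[n] e.2)‖ ≤ C := fun n e => by
    rw [norm_mul]
    exact (mul_le_mul (hkb e) (hC _) (norm_nonneg _) zero_le_one).trans_eq (one_mul C)
  have hvm : ∀ n, Measurable fun e : UnitAddCircle × UnitAddCircle =>
      pastProd α n e.1 e.2 * F e := fun n => (measurable_pastProd α n).mul hFm
  have hvb : ∀ n e, ‖pastProd α n e.1 e.2 * F e‖ ≤ C := fun n e => by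
    rw [norm_mul, norm_pastProd, one_mul]
    exact hFb e
  have hui : ∀ n, Integrable (u n) volume := fun n =>
    (Integrable.of_bound (μ := volume.prod ν) (hum n).aestronglyMeasurable C
      (Eventually.of_forall (hub n))).integral_prod_left
  have hvi : ∀ n, Integrable (v n) volume := fun n =>
    (Integrable.of_bound (μ := volume.prod volume) (hvm n).aestronglyMeasurable C
      (Eventually.of_forall (hvb n))).integral_prod_left
  -- both functions are the conditional mean of `κ * g (R^[n] y)` given `t`
  have huv : ∀ n, u n =ᵐ[volume] v n := by
    intro n
    refine (hui n).ae_eq_of_forall_setIntegral_eq _ _ (hvi n) fun A hA _ => ?_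
    let a : UnitAddCircle → ℂ := A.indicator 1
    have ham : Measurable a := measurable_one.indicator hA
    have hab : ∀ t, ‖a t‖ ≤ 1 := fun t => by
      by_cases h : t ∈ A <;> simp [a, h]
    have hset : ∀ f : UnitAddCircle → ℂ, ∫ t in A, f t = ∫ t, a t * f t := fun f => by
      rw [← integral_indicator hA]
      refine integral_congr_ae (Eventually.of_forall fun t => ?_)
      by_cases h : t ∈ A <;> simp [a, h]
    have h1 : ∫ w, a w.1.1 * g (R^[n] w.2) * ((w.1.2.2 : ℤ) : ℂ) ∂ξ = ∫ t, a t * u n t := by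
      have hi : Integrable (fun e : UnitAddCircle × Y => a e.1 * g (R^[n] e.2) * k e)
          (volume.prod ν) :=
        .of_bound (((ham.comp measurable_fst).mul
          ((hgR n).comp measurable_snd)).mul hkm).aestronglyMeasurable (1 * C * 1)
          (Eventually.of_forall fun e => by
            rw [norm_mul, norm_mul]
            exact mul_le_mul (mul_le_mul (hab _) (hC _) (norm_nonneg _) zero_le_one) (hkb _)
              (norm_nonneg _) (by positivity))
      rw [hk (fun e => a e.1 * g (R^[n] e.2)) (1 * C)
        ((ham.comp measurable_fst).mul ((hgR n).comp measurable_snd)) fun e => by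
          rw [norm_mul]; exact mul_le_mul (hab _) (hC _) (norm_nonneg _) zero_le_one]
      rw [integral_prod _ hi]
      refine integral_congr_ae (Eventually.of_forall fun t => ?_)
      simp only [u]
      rw [← integral_const_mul]
      refine integral_congr_ae (Eventually.of_forall fun y => ?_)
      simp only
      ring
    have h2 : ∫ w, a w.1.1 * pastProd α n w.1.1 w.1.2.1 * (((w.1.2.2 : ℤ) : ℂ) * g w.2) ∂ξ =
        ∫ t, a t * v n t := by
      have hi : Integrable (fun e : UnitAddCircle × UnitAddCircle =>
          a e.1 * pastProd α n e.1 e.2 * F e) (volume.prod volume) :=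
        .of_bound (((ham.comp measurable_fst).mul
          (measurable_pastProd α n)).mul hFm).aestronglyMeasurable (1 * 1 * C)
          (Eventually.of_forall fun e => by
            rw [norm_mul, norm_mul]
            exact mul_le_mul (mul_le_mul (hab _) (norm_pastProd _ _ _ _).le (norm_nonneg _)
              zero_le_one) (hFb _) (norm_nonneg _) (by positivity))
      rw [hF (fun e => a e.1 * pastProd α n e.1 e.2) (1 * 1)
        ((ham.comp measurable_fst).mul (measurable_pastProd α n)) fun e => by
          rw [norm_mul]
          exact mul_le_mul (hab _) (norm_pastProd _ _ _ _).le (norm_nonneg _) zero_le_one]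
      rw [integral_prod _ hi]
      refine integral_congr_ae (Eventually.of_forall fun t => ?_)
      simp only [v]
      rw [← integral_const_mul]
      refine integral_congr_ae (Eventually.of_forall fun s => ?_)
      simp only
      ring
    have hGm : Measurable fun w : (UnitAddCircle × UnitAddCircle × ℤˣ) × Y =>
        a w.1.1 * pastProd α n w.1.1 w.1.2.1 * (((w.1.2.2 : ℤ) : ℂ) * g w.2) :=
      ((ham.comp htm).mul ((measurable_pastProd α n).comp (htm.prodMk hsm))).mul
        (hκm.mul (hg.comp measurable_snd))
    rw [hset, hset, ← h1, ← h2]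
    -- apply invariance under `n` steps: the past of the image point is the orbit just traversed
    conv_rhs => rw [← (hinv.iterate n).map_eq]
    rw [integral_map (hinv.iterate n).measurable.aemeasurable hGm.aestronglyMeasurable]
    refine integral_congr_ae (Eventually.of_forall fun w => ?_)
    obtain ⟨⟨t, s, κ⟩, y⟩ := w
    simp only [Prod.map_iterate, Prod.map_apply, iterate_skewProduct, pastProd,
      add_sub_cancel_right]
    rcases Int.units_eq_one_or (cocycleProd α n t s) with h | h <;> rw [h] <;> push_cast <;> ring
  obtain ⟨φ, hφ, hweak⟩ := exists_subseq_tendsto_integral_mul ν (g := fun n y => g (R^[q n] y))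
    (fun n => hgR _) fun n y => hC _
  have hδ : Tendsto (fun n => |q n * α - p n|) atTop (𝓝 0) := by
    refine squeeze_zero (fun n => abs_nonneg _) (fun n => (happ n).le) ?_
    simp_rw [one_div]
    exact tendsto_inv_atTop_zero.comp (tendsto_natCast_atTop_atTop.comp hlim)
  have hdiv := ae_not_tendsto_meanSign hα (fun n => hq (φ n)) (fun n => hcop (φ n))
    (fun n => happ (φ n)) (hlim.comp hφ.tendsto_atTop)
  have hf0 : ∀ᵐ t, ∫ s, F (t, s) = 0 := by
    filter_upwards [hdiv, ae_all_iff.2 huv] with t ht huvt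
    by_contra hne
    obtain ⟨l, hl⟩ := hweak (fun y => k (t, y)) 1 (hkm.comp (measurable_const.prodMk measurable_id))
      fun y => hkb _
    have h1 : Tendsto (fun n => v (q (φ n)) t) atTop (𝓝 l) := hl.congr fun n => huvt (q (φ n))
    have h2 := (tendsto_integral_pastProd_mul_sub hα hδ t (hFi t)).comp hφ.tendsto_atTop
    have h3 := h1.sub h2
    refine ht (exists_tendsto_of_tendsto_ofReal_mul hne (h3.congr fun n => ?_))
    simp only [v, Function.comp_apply, sub_sub_cancel]
  have hfin := hF (fun _ => 1) 1 measurable_const fun _ => by simp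
  simp only [one_mul] at hfin
  rw [hfin, integral_prod _ (.of_bound hFm.aestronglyMeasurable C (Eventually.of_forall hFb))]
  simp [integral_congr_ae hf0]

/-! ### The codings are injective -/

/-- Right-continuous functions that agree on a dense forward orbit are equal. -/
theorem eq_of_eqOn_orbit {α : ℝ} (hα : Irrational α) {X : Type*} {f f' : UnitAddCircle → X}
    (hf : ∀ u, ∃ ε > 0, ∀ h ∈ Set.Ico (0 : ℝ) ε, f (u + (h : UnitAddCircle)) = f u)
    (hf' : ∀ u, ∃ ε > 0, ∀ h ∈ Set.Ico (0 : ℝ) ε, f' (u + (h : UnitAddCircle)) = f' u)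
    {s : UnitAddCircle}
    (heq : ∀ n : ℕ, f (s + n • (α : UnitAddCircle)) = f' (s + n • (α : UnitAddCircle))) :
    f = f' := by
  funext u
  obtain ⟨ε, hε, h⟩ := hf u
  obtain ⟨ε', hε', h'⟩ := hf' u
  have hdense : DenseRange fun n : ℕ => n • (α : UnitAddCircle) := by
    rw [← denseRange_zsmul_iff_nsmul, AddCircle.denseRange_zsmul_coe_iff, div_one]
    exact hα
  have hopen : IsOpen ((fun x : ℝ => (x : UnitAddCircle)) '' Set.Ioo 0 (min ε ε')) :=
    QuotientAddGroup.isOpenMap_coe _ isOpen_Ioo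
  have hU : IsOpen ((fun x : UnitAddCircle => s + x - u) ⁻¹'
      ((fun x : ℝ => (x : UnitAddCircle)) '' Set.Ioo 0 (min ε ε'))) :=
    hopen.preimage (by fun_prop)
  obtain ⟨n, x, hx, hxn⟩ := hdense.exists_mem_open hU (by
    refine ⟨u - s + ((min ε ε' / 2 : ℝ) : UnitAddCircle), min ε ε' / 2, ?_, ?_⟩
    · have := lt_min hε hε'
      constructor <;> linarith
    · change _ = s + (u - s + ((min ε ε' / 2 : ℝ) : UnitAddCircle)) - u
      abel)
  have hxn' : s + n • (α : UnitAddCircle) = u + (x : UnitAddCircle) := by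
    rw [show (x : UnitAddCircle) = s + n • (α : UnitAddCircle) - u from hxn]
    abel
  have h1 := heq n
  rwa [hxn', h x ⟨hx.1.le, hx.2.trans_le (min_le_left _ _)⟩,
    h' x ⟨hx.1.le, hx.2.trans_le (min_le_right _ _)⟩] at h1

theorem cocycle_right_continuous (t u : UnitAddCircle) :
    ∃ ε > 0, ∀ h ∈ Set.Ico (0 : ℝ) ε, cocycle t (u + (h : UnitAddCircle)) = cocycle t u := by
  obtain ⟨h0, h1⟩ := rep_mem u
  have hrep : ∀ h, 0 ≤ h → h < 1 - rep u → rep (u + (h : UnitAddCircle)) = rep u + h := by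
    intro h hh hh1
    have e : u + (h : UnitAddCircle) = ((rep u + h : ℝ) : UnitAddCircle) := by
      rw [AddCircle.coe_add, coe_rep]
    rw [e, rep_coe, Int.fract_eq_self]
    constructor <;> linarith
  by_cases hlt : rep u < rep t
  · refine ⟨min (1 - rep u) (rep t - rep u), lt_min (by linarith) (by linarith), fun h hh => ?_⟩
    have h2 := lt_min_iff.1 hh.2
    rw [cocycle, cocycle, hrep h hh.1 h2.1, if_pos hlt, if_pos (by linarith)]
  · refine ⟨1 - rep u, by linarith, fun h hh => ?_⟩
    have := hh.1
    rw [cocycle, cocycle, hrep h hh.1 hh.2, if_neg hlt, if_neg (by linarith)]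

theorem cocycle_cast_eq (t s : UnitAddCircle) : ((cocycle t s : ℤ) : ℝ) =
    1 - 2 * (Set.Iio (rep t)).indicator (fun _ => 1) (rep s) := by
  by_cases h : rep s < rep t
  · rw [cocycle, if_pos h, Set.indicator_of_mem (Set.mem_Iio.2 h)]; norm_num
  · rw [cocycle, if_neg h, Set.indicator_of_notMem (by simpa using h)]; norm_num

theorem integral_comp_rep {f : ℝ → ℝ} (hf : Measurable f) :
    ∫ s : UnitAddCircle, f (rep s) = ∫ x in Set.Ioc (0 : ℝ) 1, f x := by
  rw [← measurePreserving_rep.map_eq, integral_map measurable_rep.aemeasurable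
    hf.aestronglyMeasurable]

/-- Integrals against the cocycle as a function of `s`. -/
theorem integral_mul_cocycle {f : ℝ → ℝ} (hf : Continuous f) (t : UnitAddCircle) :
    ∫ s : UnitAddCircle, f (rep s) * ((cocycle t s : ℤ) : ℝ) =
      (∫ x in (0 : ℝ)..1, f x) - 2 * ∫ x in (0 : ℝ)..rep t, f x := by
  obtain ⟨h0, h1⟩ := rep_mem t
  have hm : Measurable fun x => f x - 2 * (Set.Iio (rep t)).indicator f x :=
    hf.measurable.sub ((hf.measurable.indicator measurableSet_Iio).const_mul 2)
  have hi : IntegrableOn f (Set.Ioc 0 1) := hf.integrableOn_Ioc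
  have e : ∀ s : UnitAddCircle, f (rep s) * ((cocycle t s : ℤ) : ℝ) =
      f (rep s) - 2 * (Set.Iio (rep t)).indicator f (rep s) := fun s => by
    rw [cocycle_cast_eq]
    by_cases h : rep s ∈ Set.Iio (rep t)
    · rw [Set.indicator_of_mem h, Set.indicator_of_mem h]; ring
    · rw [Set.indicator_of_notMem h, Set.indicator_of_notMem h]; ring
  have hset : Set.Iio (rep t) ∩ Set.Ioc (0 : ℝ) 1 = Set.Ioo 0 (rep t) := by
    ext x
    simp only [Set.mem_inter_iff, Set.mem_Iio, Set.mem_Ioc, Set.mem_Ioo]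
    constructor
    · rintro ⟨a, b, c⟩; exact ⟨b, a⟩
    · rintro ⟨a, b⟩; exact ⟨b, a, by linarith⟩
  simp_rw [e]
  rw [integral_comp_rep hm, integral_sub hi ((hi.indicator measurableSet_Iio).const_mul 2),
    integral_const_mul, integral_indicator measurableSet_Iio,
    Measure.restrict_restrict measurableSet_Iio, hset, ← integral_Ioc_eq_integral_Ioo,
    intervalIntegral.integral_of_le zero_le_one, intervalIntegral.integral_of_le h0]

theorem integral_cocycle (t : UnitAddCircle) :
    ∫ s, ((cocycle t s : ℤ) : ℝ) = 1 - 2 * rep t := by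
  simpa using integral_mul_cocycle (f := fun _ => 1) continuous_const t

theorem integral_cocycle_left (s : UnitAddCircle) :
    ∫ t, ((cocycle t s : ℤ) : ℝ) = 2 * rep s - 1 := by
  obtain ⟨h0, h1⟩ := rep_mem s
  have hm : Measurable fun x : ℝ => 1 - 2 * (Set.Ioi (rep s)).indicator (fun _ => (1 : ℝ)) x :=
    measurable_const.sub ((measurable_const.indicator measurableSet_Ioi).const_mul 2)
  have e : ∀ t : UnitAddCircle, ((cocycle t s : ℤ) : ℝ) =
      1 - 2 * (Set.Ioi (rep s)).indicator (fun _ => 1) (rep t) := fun t => by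
    rw [cocycle_cast_eq]
    rfl
  simp_rw [e]
  rw [integral_comp_rep hm, integral_sub (integrable_const _)
    (((integrable_const _).indicator measurableSet_Ioi).const_mul 2),
    integral_const_mul, integral_indicator measurableSet_Ioi,
    Measure.restrict_restrict measurableSet_Ioi, Set.inter_comm, Set.Ioc_inter_Ioi,
    max_eq_right h0]
  simp [h1.le]
  ring

theorem rep_pos {t : UnitAddCircle} (ht : t ≠ 0) : 0 < rep t := by
  refine lt_of_le_of_ne (rep_mem t).1 fun h => ht ?_
  rw [← coe_rep t, ← h, AddCircle.coe_zero]

/-- The symbolic coding of the rotation determines both the coded arc and the starting point. -/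
theorem rotationCode_injective {α : ℝ} (hα : Irrational α) {t t' s s' : UnitAddCircle}
    (ht : t ≠ 0) (h : rotationCode α t s = rotationCode α t' s') : t = t' ∧ s = s' := by
  have hcode : ∀ n : ℕ, cocycle t (s + n • (α : UnitAddCircle)) =
      cocycle t' (s' + n • (α : UnitAddCircle)) := fun n => by
    have := congrFun h n
    simp only [rotationCode] at this
    exact_mod_cast this
  have hall : cocycle t = fun u => cocycle t' (u + (s' - s)) := by
    refine eq_of_eqOn_orbit hα (cocycle_right_continuous t) (fun u => ?_) (s := s) fun n => ?_
    · obtain ⟨ε, hε, hh⟩ := cocycle_right_continuous t' (u + (s' - s))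
      refine ⟨ε, hε, fun x hx => ?_⟩
      rw [add_right_comm]
      exact hh x hx
    · rw [hcode]
      congr 1
      abel
  have htt : t = t' := by
    have h1 := integral_cocycle t
    rw [hall, integral_add_right_eq_self (fun u => ((cocycle t' u : ℤ) : ℝ)),
      integral_cocycle] at h1
    exact rep_injective (by linarith)
  refine ⟨htt, ?_⟩
  subst htt
  by_contra hne
  set β := s' - s with hβ
  have hβ0 : β ≠ 0 := sub_ne_zero.2 (Ne.symm hne)
  have hb := rep_pos hβ0
  have htp := rep_pos ht
  have h0 : cocycle t 0 = -1 := by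
    have : rep (0 : UnitAddCircle) = 0 := by simpa using rep_coe 0
    rw [cocycle, if_pos (by rw [this]; exact htp)]
  -- `β` lies in the arc `[0, t)`, as `0` does
  have hbt : rep β < rep t := by
    have h1 := congrFun hall 0
    simp only [h0, zero_add] at h1
    by_contra hnot
    rw [cocycle, if_neg hnot] at h1
    exact absurd h1 (by decide)
  -- `t - β` lies in the arc `[0, t)`, while its translate `t` by `β` does not
  have h1 := congrFun hall (t - β)
  simp only [sub_add_cancel] at h1
  have hr : rep (t - β) = rep t - rep β := by
    have e : t - β = ((rep t - rep β : ℝ) : UnitAddCircle) := by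
      rw [AddCircle.coe_sub, coe_rep, coe_rep]
    rw [e, rep_coe, Int.fract_eq_self]
    exact ⟨by linarith, by linarith [(rep_mem t).2]⟩
  rw [cocycle, cocycle, if_pos (by rw [hr]; linarith), if_neg (lt_irrefl _)] at h1
  exact absurd h1 (by decide)

/-! ### The skew product and its symbolic representation -/

/-- The invariant measure `dt × ds × dκ` of the skew product. -/
def skewMeasure : Measure (UnitAddCircle × UnitAddCircle × ℤˣ) :=
  (volume : Measure UnitAddCircle).prod ((volume : Measure UnitAddCircle).prod haarSign)

instance : IsProbabilityMeasure haarSign := ⟨by simp [haarSign, ENNReal.inv_two_add_inv_two]⟩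

instance : IsProbabilityMeasure skewMeasure := by unfold skewMeasure; infer_instance

theorem map_mul_haarSign (u : ℤˣ) : haarSign.map (· * u) = haarSign := by
  have hm : Measurable fun κ : ℤˣ => κ * u := measurable_of_countable _
  rw [haarSign, Measure.map_add _ _ hm, Measure.map_smul, Measure.map_smul,
    Measure.map_dirac' hm, Measure.map_dirac' hm]
  rcases Int.units_eq_one_or u with rfl | rfl
  · simp
  · simp [add_comm]

theorem measurePreserving_skewProduct (α : ℝ) :
    MeasurePreserving (skewProduct α) skewMeasure skewMeasure := by
  have hmul : Measurable fun p : ℤˣ × ℤˣ => p.1 * p.2 := measurable_of_countable _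
  have h1 : ∀ t : UnitAddCircle, MeasurePreserving
      (fun p : UnitAddCircle × ℤˣ => (p.1 + (α : UnitAddCircle), p.2 * cocycle t p.1))
      ((volume : Measure UnitAddCircle).prod haarSign)
      ((volume : Measure UnitAddCircle).prod haarSign) := fun t =>
    (measurePreserving_add_right volume (α : UnitAddCircle)).skew_product
      (g := fun s κ => κ * cocycle t s)
      (hmul.comp (measurable_snd.prodMk
        (measurable_cocycle.comp (measurable_const.prodMk measurable_fst)) :))
      (Eventually.of_forall fun s => map_mul_haarSign _)
  refine (MeasurePreserving.id (volume : Measure UnitAddCircle)).skew_product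
    (g := fun (t : UnitAddCircle) (p : UnitAddCircle × ℤˣ) =>
      (p.1 + (α : UnitAddCircle), p.2 * cocycle t p.1)) ?_
    (Eventually.of_forall fun t => (h1 t).map_eq)
  have h2 : Measurable fun w : UnitAddCircle × UnitAddCircle × ℤˣ => cocycle w.1 w.2.1 :=
    (measurable_cocycle.comp (measurable_fst.prodMk (measurable_fst.comp measurable_snd)) :)
  exact ((measurable_fst.comp measurable_snd).add_const _).prodMk
    (hmul.comp ((measurable_snd.comp measurable_snd).prodMk h2) :)

theorem measurable_shift : Measurable shift :=
  measurable_pi_lambda _ fun n => measurable_pi_apply (n + 1)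

theorem measurable_itinerary (α : ℝ) : Measurable (itinerary α) :=
  measurable_pi_lambda _ fun n => measurable_sign_cast.comp (measurable_snd.comp
    (measurable_snd.comp ((measurePreserving_skewProduct α).measurable.iterate n)))

theorem itinerary_skewProduct (α : ℝ) (p : UnitAddCircle × UnitAddCircle × ℤˣ) :
    itinerary α (skewProduct α p) = shift (itinerary α p) := rfl

theorem itinerary_mul_succ (α : ℝ) (t s : UnitAddCircle) (κ : ℤˣ) (n : ℕ) :
    itinerary α (t, s, κ) n * itinerary α (t, s, κ) (n + 1) = rotationCode α t s n := by
  rw [itinerary, itinerary, Function.iterate_succ_apply', iterate_skewProduct]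
  simp only [skewProduct, rotationCode]
  rcases Int.units_eq_one_or (κ * cocycleProd α n t s) with h | h <;> rw [h] <;> push_cast <;> ring

theorem itinerary_mem (α : ℝ) (p : UnitAddCircle × UnitAddCircle × ℤˣ) :
    itinerary α p ∈ sequences {-1, 1} := fun n => by
  rcases Int.units_eq_one_or ((skewProduct α)^[n] p).2.2 with h | h <;> simp [itinerary, h]

theorem itinerary_injOn {α : ℝ} (hα : Irrational α) :
    Set.InjOn (itinerary α) {p | p.1 ≠ 0} := by
  rintro ⟨t, s, κ⟩ ht ⟨t', s', κ'⟩ - h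
  have hcode : rotationCode α t s = rotationCode α t' s' := funext fun n => by
    rw [← itinerary_mul_succ α t s κ, ← itinerary_mul_succ α t' s' κ', h]
  obtain ⟨rfl, rfl⟩ := rotationCode_injective hα ht hcode
  have h0 : ((κ : ℤ) : ℂ) = ((κ' : ℤ) : ℂ) := congrFun h 0
  have : κ = κ' := Units.ext (by exact_mod_cast h0)
  rw [this]

theorem ae_skewMeasure_ne_zero : ∀ᵐ p ∂skewMeasure, p.1 ≠ 0 := by
  have h : ∀ᵐ t : UnitAddCircle, t ≠ 0 := by
    rw [ae_iff]
    have h0 := AddCircle.volume_closedBall (1 : ℝ) (x := 0) 0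
    simpa [Metric.closedBall_zero] using h0
  exact Measure.quasiMeasurePreserving_fst.ae (p := fun t : UnitAddCircle => t ≠ 0) h

/-- The itinerary map has a measurable left inverse off the null set `t = 0`, on which the cocycle
is trivial. -/
theorem exists_decoding {α : ℝ} (hα : Irrational α) :
    ∃ Θ : (ℕ → ℂ) → UnitAddCircle × UnitAddCircle × ℤˣ, Measurable Θ ∧
      ∀ p : UnitAddCircle × UnitAddCircle × ℤˣ, p.1 ≠ 0 → Θ (itinerary α p) = p := by
  have hms : MeasurableSet {p : UnitAddCircle × UnitAddCircle × ℤˣ | p.1 ≠ 0} :=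
    measurable_fst (measurableSet_singleton (0 : UnitAddCircle)).compl
  have : StandardBorelSpace {p : UnitAddCircle × UnitAddCircle × ℤˣ | p.1 ≠ 0} :=
    hms.standardBorel
  have hemb : MeasurableEmbedding fun p : {p : UnitAddCircle × UnitAddCircle × ℤˣ | p.1 ≠ 0} =>
      itinerary α p :=
    ((measurable_itinerary α).comp measurable_subtype_coe).measurableEmbedding
      (itinerary_injOn hα).injective
  obtain ⟨Θ, hΘ, h⟩ := hemb.exists_measurable_extend measurable_subtype_coe
    fun _ => ⟨((0, 0, 1) : UnitAddCircle × UnitAddCircle × ℤˣ)⟩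
  exact ⟨Θ, hΘ, fun p hp => congrFun h ⟨p, hp⟩⟩

theorem measurableSet_sequences {K : Set ℂ} (hK : MeasurableSet K) :
    MeasurableSet {x : ℕ → ℂ | x ∈ sequences K} := by
  have : {x : ℕ → ℂ | x ∈ sequences K} = ⋂ n, {x | x n ∈ K} := by
    ext x; simp [sequences]
  rw [this]
  exact MeasurableSet.iInter fun n => measurable_pi_apply n hK

theorem isShiftMeasure_extensionMeasure (α : ℝ) :
    IsShiftMeasure {-1, 1} (extensionMeasure α) where
  prob := Measure.isProbabilityMeasure_map (μ := skewMeasure) (measurable_itinerary α).aemeasurable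
  invariant := ((measurable_itinerary α).measurePreserving skewMeasure).of_semiconj
    (measurePreserving_skewProduct α) (itinerary_skewProduct α) measurable_shift
  supported := (ae_map_iff (measurable_itinerary α).aemeasurable
    (measurableSet_sequences (Set.toFinite _).measurableSet)).2
      (Eventually.of_forall (itinerary_mem α))

/-- The symbolic representation of the skew product is uncorrelated to every ergodic measure: a
joining is decoded to a coupling of the skew product with the ergodic system. -/
theorem uncorrelatedToErgodic_extensionMeasure {α : ℝ} (hα : Irrational α) :
    UncorrelatedToErgodic (extensionMeasure α) := by
  intro K ν hK hν
  simp only [corr, ENNReal.iSup_eq_zero]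
  intro ξ hξ
  rw [enorm_eq_zero]
  obtain ⟨Θ, hΘ, hdec⟩ := exists_decoding hα
  have hμp := (isShiftMeasure_extensionMeasure α).prob
  have hξp : IsProbabilityMeasure ξ := ⟨by
    rw [← hμp.measure_univ, ← hξ.fst_eq, Measure.map_apply measurable_fst MeasurableSet.univ,
      Set.preimage_univ]⟩
  -- almost every sequence is the itinerary of its decoding, which intertwines the dynamics
  have hae : ∀ᵐ x ∂(extensionMeasure α),
      itinerary α (Θ x) = x ∧ Θ (shift x) = skewProduct α (Θ x) := by
    refine (ae_map_iff (measurable_itinerary α).aemeasurable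
      ((measurableSet_eq_fun ((measurable_itinerary α).comp hΘ) measurable_id).inter
      (measurableSet_eq_fun (hΘ.comp measurable_shift)
        ((measurePreserving_skewProduct α).measurable.comp hΘ)))).2 ?_
    filter_upwards [ae_skewMeasure_ne_zero] with p hp
    refine ⟨congrArg _ (hdec p hp), ?_⟩
    change Θ (shift (itinerary α p)) = skewProduct α (Θ (itinerary α p))
    rw [← itinerary_skewProduct, hdec p hp]
    exact hdec (skewProduct α p) hp
  have hfst : MeasurePreserving Prod.fst ξ (extensionMeasure α) := ⟨measurable_fst, hξ.fst_eq⟩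
  have hsnd : MeasurePreserving Prod.snd ξ ν := ⟨measurable_snd, hξ.snd_eq⟩
  have haeξ := hfst.quasiMeasurePreserving.ae hae
  have hΘi : Measurable (Prod.map Θ (id : (ℕ → ℂ) → ℕ → ℂ)) := hΘ.prodMap measurable_id
  have hmapΘ : (extensionMeasure α).map Θ = skewMeasure := by
    change (skewMeasure.map (itinerary α)).map Θ = skewMeasure
    rw [Measure.map_map hΘ (measurable_itinerary α)]
    conv_rhs => rw [← Measure.map_id (μ := skewMeasure)]
    refine Measure.map_congr ?_
    filter_upwards [ae_skewMeasure_ne_zero] with p hp using hdec p hp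
  set ξ' := ξ.map (Prod.map Θ id) with hξ'
  have : IsProbabilityMeasure ξ' := Measure.isProbabilityMeasure_map hΘi.aemeasurable
  have hts : ξ'.map (fun w => (w.1.1, w.1.2.1)) = volume.prod volume := by
    have hm : Measurable fun p : UnitAddCircle × UnitAddCircle × ℤˣ => (p.1, p.2.1) :=
      measurable_fst.prodMk (measurable_fst.comp measurable_snd)
    have h1 : ξ'.map Prod.fst = skewMeasure := by
      rw [hξ', Measure.map_map measurable_fst hΘi, ← hmapΘ, ← hξ.fst_eq,
        Measure.map_map hΘ measurable_fst]
      rfl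
    have h2 : ξ'.map (fun w => (w.1.1, w.1.2.1)) =
        (ξ'.map Prod.fst).map fun p => (p.1, p.2.1) := by
      rw [Measure.map_map hm measurable_fst]
      rfl
    have h3 := Measure.map_prod_map (volume : Measure UnitAddCircle)
      ((volume : Measure UnitAddCircle).prod haarSign) measurable_id
      (measurable_fst (α := UnitAddCircle) (β := ℤˣ))
    rw [Measure.map_id, Measure.map_fst_prod, measure_univ, one_smul] at h3
    rw [h2, h1, h3]
    rfl
  have hS := (measurePreserving_skewProduct α).measurable
  have hinv : MeasurePreserving (Prod.map (skewProduct α) shift) ξ' ξ' := by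
    refine ⟨hS.prodMap measurable_shift, ?_⟩
    rw [hξ', Measure.map_map (hS.prodMap measurable_shift) hΘi]
    conv_rhs => rw [← hξ.invariant.map_eq, Measure.map_map hΘi hξ.invariant.measurable]
    refine Measure.map_congr ?_
    filter_upwards [haeξ] with w hw
    exact Prod.ext hw.2.symm rfl
  have hsnd' : ξ'.map Prod.snd = ν := by
    rw [hξ', Measure.map_map measurable_snd hΘi, ← hξ.snd_eq]
    rfl
  have key : ∀ (g : (ℕ → ℂ) → ℂ) (C : ℝ), Measurable g → (∀ y, ‖g y‖ ≤ C) →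
      ∫ w, w.1 0 * g w.2 ∂ξ = 0 := by
    intro g C hg hC
    have hm : Measurable fun w : (UnitAddCircle × UnitAddCircle × ℤˣ) × (ℕ → ℂ) =>
        ((w.1.2.2 : ℤ) : ℂ) * g w.2 :=
      (measurable_sign_cast.comp (measurable_snd.comp (measurable_snd.comp measurable_fst))).mul
        (hg.comp measurable_snd)
    have h := integral_sign_mul_eq_zero hα hts hinv (by rw [hsnd']; exact hν.ergodic) hg hC
    rw [hξ', integral_map hΘi.aemeasurable hm.aestronglyMeasurable] at h
    rw [← h]
    refine integral_congr_ae ?_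
    filter_upwards [haeξ] with w hw
    have h0 : (((Θ w.1).2.2 : ℤ) : ℂ) = w.1 0 := congrFun hw.1 0
    change w.1 0 * g w.2 = (((Θ w.1).2.2 : ℤ) : ℂ) * g w.2
    rw [h0]
  have hmean : ∫ x, x 0 ∂(extensionMeasure α) = 0 := by
    have hm : Measurable fun x : ℕ → ℂ => x 0 := measurable_pi_apply 0
    rw [← hξ.fst_eq, integral_map measurable_fst.aemeasurable hm.aestronglyMeasurable]
    simpa using key (fun _ => 1) 1 measurable_const fun _ => by simp
  -- the second coordinate is almost surely bounded, since the alphabet is compact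
  obtain ⟨C, hC⟩ := hK.isBounded.exists_norm_le
  have hg : Measurable ((fun y : ℕ → ℂ => y 0) ⁻¹' K |>.indicator fun y => conj (y 0)) :=
    (Complex.continuous_conj.measurable.comp (measurable_pi_apply 0)).indicator
      (measurable_pi_apply 0 hK.isClosed.measurableSet)
  have hcorr := key _ (max C 0) hg fun y => by
    by_cases hy : y 0 ∈ K
    · rw [Set.indicator_of_mem (by exact hy), RCLike.norm_conj]
      exact (hC _ hy).trans (le_max_left _ _)
    · rw [Set.indicator_of_notMem (by exact hy), norm_zero]
      exact le_max_right _ _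
  rw [hmean, zero_mul, sub_zero, ← hcorr]
  refine integral_congr_ae ?_
  filter_upwards [hsnd.quasiMeasurePreserving.ae hν.supported] with w hw
  rw [Set.indicator_of_mem (by exact hw 0)]

/-! ### The code is a conjugacy -/

theorem continuous_code : Continuous code :=
  continuous_pi fun n => by unfold code; fun_prop

theorem code_mem_sequences {x : ℕ → ℂ} (hx : x ∈ sequences {-1, 1}) :
    code x ∈ sequences {-1, -1 / 2, 1 / 2, 1} := by
  intro n
  have h0 := hx n
  have h1 := hx (n + 1)
  simp only [Set.mem_insert_iff, Set.mem_singleton_iff] at h0 h1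
  rcases h0 with h0 | h0 <;> rcases h1 with h1 | h1 <;> simp only [code, h0, h1] <;> norm_num

theorem code_injOn : Set.InjOn code (sequences {-1, 1}) := by
  intro x hx y hy h
  funext n
  have hn := congrFun h n
  have h0 := hx n
  have h1 := hx (n + 1)
  have h2 := hy n
  have h3 := hy (n + 1)
  simp only [Set.mem_insert_iff, Set.mem_singleton_iff] at h0 h1 h2 h3
  simp only [code] at hn
  rcases h0 with h0 | h0 <;> rcases h2 with h2 | h2 <;> rcases h1 with h1 | h1 <;>
    rcases h3 with h3 | h3 <;> rw [h0, h1, h2, h3] at hn <;> rw [h0, h2] <;> norm_num at hn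

theorem IsSubshift.isCompact {K : Set ℂ} (hK : IsCompact K) {X : Set (ℕ → ℂ)}
    (hX : IsSubshift K X) : IsCompact X := by
  refine (isCompact_univ_pi fun _ : ℕ => hK).of_isClosed_subset hX.2.1 fun x hx n _ => ?_
  exact hX.1 hx n

theorem isCompact_signs : IsCompact ({-1, 1} : Set ℂ) := (Set.toFinite _).isCompact

theorem IsSubshift.code {X : Set (ℕ → ℂ)} (hX : IsSubshift {-1, 1} X) :
    IsSubshift {-1, -1 / 2, 1 / 2, 1} (code '' X) := by
  refine ⟨?_, ((hX.isCompact isCompact_signs).image continuous_code).isClosed, ?_⟩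
  · rintro _ ⟨x, hx, rfl⟩
    exact code_mem_sequences (hX.1 hx)
  · rintro _ ⟨x, hx, rfl⟩
    exact ⟨shift x, hX.2.2 hx, rfl⟩

theorem isConjugacy_code {X : Set (ℕ → ℂ)} (hX : IsSubshift {-1, 1} X) :
    IsConjugacy X (SymbolicCorrelation.code '' X) SymbolicCorrelation.code := by
  have : CompactSpace X := isCompact_iff_compactSpace.1 (hX.isCompact isCompact_signs)
  let e := Equiv.Set.imageOfInjOn SymbolicCorrelation.code X (code_injOn.mono hX.1)
  have he : Continuous e := (continuous_code.comp continuous_subtype_val).subtype_mk _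
  exact ⟨⟨he.homeoOfEquivCompactToT2, fun x => rfl⟩, fun x _ => rfl⟩

theorem isSubshift_sequences_signs : IsSubshift {-1, 1} (sequences {-1, 1}) := by
  refine ⟨subset_rfl, ?_, fun x hx n => hx (n + 1)⟩
  have : sequences {-1, 1} = ⋂ n, (fun x : ℕ → ℂ => x n) ⁻¹' {-1, 1} := by
    ext x; simp [sequences]
  rw [this]
  exact isClosed_iInter fun n => isCompact_signs.isClosed.preimage (continuous_apply n)

theorem IsShiftMeasure.map_code {μ : Measure (ℕ → ℂ)} (hμ : IsShiftMeasure {-1, 1} μ) :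
    IsShiftMeasure {-1, -1 / 2, 1 / 2, 1} (μ.map SymbolicCorrelation.code) where
  prob := have := hμ.prob
    Measure.isProbabilityMeasure_map continuous_code.measurable.aemeasurable
  invariant := (continuous_code.measurable.measurePreserving μ).of_semiconj hμ.invariant
    (fun _ => rfl) measurable_shift
  supported := by
    refine (ae_map_iff continuous_code.measurable.aemeasurable
      (measurableSet_sequences (Set.toFinite _).measurableSet)).2 ?_
    filter_upwards [hμ.supported] with x hx using code_mem_sequences hx

/-! ### The codings of the rotation -/

theorem rotationCode_add (α : ℝ) (t s : UnitAddCircle) :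
    rotationCode α t (s + (α : UnitAddCircle)) = shift (rotationCode α t s) := by
  funext n
  simp only [rotationCode, shift, succ_nsmul', add_assoc]

theorem measurable_rotationCode (α : ℝ) (t : UnitAddCircle) : Measurable (rotationCode α t) :=
  measurable_pi_lambda _ fun n => by
    unfold rotationCode
    exact (measurable_sign_cast.comp (measurable_cocycle.comp
      (measurable_const.prodMk (measurable_id.add_const _))) :)

theorem isErgodicShiftMeasure_rotationMeasure {α : ℝ} (hα : Irrational α) (t : UnitAddCircle) :
    IsErgodicShiftMeasure {-1, 1} (rotationMeasure α t) := by
  have hm := measurable_rotationCode α t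
  have herg : Ergodic shift (rotationMeasure α t) :=
    (hm.measurePreserving volume).ergodic_of_ergodic_semiconj (ergodic_rotation hα)
      measurable_shift (rotationCode_add α t)
  refine ⟨⟨Measure.isProbabilityMeasure_map hm.aemeasurable, herg.toMeasurePreserving, ?_⟩, herg⟩
  refine (ae_map_iff hm.aemeasurable
    (measurableSet_sequences (Set.toFinite _).measurableSet)).2 (Eventually.of_forall fun s n => ?_)
  rcases Int.units_eq_one_or (cocycle t (s + n • (α : UnitAddCircle))) with h | h <;>
    simp [rotationCode, h]

/-! ### Correlation of the image measure with the codings of the rotation -/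

theorem integral_haarSign (f : ℤˣ → ℝ) : ∫ κ, f κ ∂haarSign = (f 1 + f (-1)) / 2 := by
  have hi : ∀ κ : ℤˣ, Integrable f ((2⁻¹ : ℝ≥0∞) • Measure.dirac κ) := fun κ =>
    (integrable_dirac (by simp)).smul_measure (by simp)
  rw [haarSign, integral_add_measure (hi _) (hi _), integral_smul_measure, integral_smul_measure,
    integral_dirac, integral_dirac]
  simp
  ring

/-- Integrals of the first symbol of the coded sequence against a function of `s`: averaging over
`κ` kills the linear term, and averaging the cocycle over `t` leaves `2s - 1`. -/
theorem integral_code_mul {h : UnitAddCircle → ℝ} (hm : Measurable h) (hb : ∀ s, |h s| ≤ 1) :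
    ∫ p, (3 / 4 * ((p.2.2 : ℤ) : ℝ) + 1 / 4 * ((cocycle p.1 p.2.1 : ℤ) : ℝ)) * h p.2.1
      ∂skewMeasure = 1 / 4 * ∫ s, (2 * rep s - 1) * h s := by
  have hcast : Measurable fun u : ℤˣ => ((u : ℤ) : ℝ) := measurable_of_countable _
  have hφ : Measurable fun p : UnitAddCircle × UnitAddCircle => ((cocycle p.1 p.2 : ℤ) : ℝ) :=
    (hcast.comp measurable_cocycle :)
  have hF : Measurable fun p : UnitAddCircle × UnitAddCircle × ℤˣ =>
      (3 / 4 * ((p.2.2 : ℤ) : ℝ) + 1 / 4 * ((cocycle p.1 p.2.1 : ℤ) : ℝ)) * h p.2.1 := by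
    refine Measurable.mul (Measurable.add ?_ ?_) ?_
    · exact (hcast.comp (measurable_snd.comp measurable_snd)).const_mul _
    · exact ((hφ.comp (measurable_fst.prodMk (measurable_fst.comp measurable_snd)) :)).const_mul _
    · exact (hm.comp (measurable_fst.comp measurable_snd) :)
  have hFb : ∀ p : UnitAddCircle × UnitAddCircle × ℤˣ,
      ‖(3 / 4 * ((p.2.2 : ℤ) : ℝ) + 1 / 4 * ((cocycle p.1 p.2.1 : ℤ) : ℝ)) * h p.2.1‖ ≤ 1 := by
    intro p
    rw [Real.norm_eq_abs, abs_mul]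
    refine mul_le_one₀ ?_ (abs_nonneg _) (hb _)
    refine (abs_add_le _ _).trans ?_
    rw [abs_mul, abs_mul, abs_sign_cast, abs_sign_cast]
    norm_num
  have hinner : ∀ t : UnitAddCircle,
      ∫ r : UnitAddCircle × ℤˣ, (3 / 4 * ((r.2 : ℤ) : ℝ) + 1 / 4 * ((cocycle t r.1 : ℤ) : ℝ)) *
        h r.1 ∂(volume.prod haarSign) = ∫ s, 1 / 4 * (((cocycle t s : ℤ) : ℝ) * h s) := by
    intro t
    have hFt : Measurable fun r : UnitAddCircle × ℤˣ =>
        (3 / 4 * ((r.2 : ℤ) : ℝ) + 1 / 4 * ((cocycle t r.1 : ℤ) : ℝ)) * h r.1 :=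
      (hF.comp (measurable_const.prodMk measurable_id) :)
    have hi : Integrable (fun r : UnitAddCircle × ℤˣ =>
        (3 / 4 * ((r.2 : ℤ) : ℝ) + 1 / 4 * ((cocycle t r.1 : ℤ) : ℝ)) * h r.1)
        (volume.prod haarSign) :=
      .of_bound hFt.aestronglyMeasurable 1 (Eventually.of_forall fun r => hFb (t, r))
    rw [integral_prod _ hi]
    refine integral_congr_ae (Eventually.of_forall fun s => ?_)
    simp only
    rw [integral_haarSign]
    push_cast
    ring
  rw [skewMeasure, integral_prod _ (.of_bound hF.aestronglyMeasurable 1 (Eventually.of_forall hFb))]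
  simp only
  simp_rw [hinner, integral_const_mul]
  congr 1
  rw [integral_integral_swap]
  · refine integral_congr_ae (Eventually.of_forall fun s => ?_)
    simp only
    rw [integral_mul_const, integral_cocycle_left]
  · refine .of_bound (hφ.mul (hm.comp measurable_snd)).aestronglyMeasurable 1
      (Eventually.of_forall fun p => ?_)
    change |((cocycle p.1 p.2 : ℤ) : ℝ) * h p.2| ≤ 1
    rw [abs_mul, abs_sign_cast, one_mul]
    exact hb _

theorem code_itinerary_zero (α : ℝ) (p : UnitAddCircle × UnitAddCircle × ℤˣ) :
    code (itinerary α p) 0 = ((3 / 4 * ((p.2.2 : ℤ) : ℝ) + 1 / 4 *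
      ((cocycle p.1 p.2.1 : ℤ) : ℝ) : ℝ) : ℂ) := by
  obtain ⟨t, s, κ⟩ := p
  have h0 : itinerary α (t, s, κ) 0 = ((κ : ℤ) : ℂ) := rfl
  rw [code, itinerary_mul_succ, h0, rotationCode, zero_smul, add_zero]
  push_cast
  rfl

/-- The coded skew product and the coding of the rotation on its second coordinate form a joining
whose correlation is `t (1 - t) / 2`. -/
theorem corr_map_code_rotationMeasure_ne_zero (α : ℝ) {t₀ : UnitAddCircle} (ht : t₀ ≠ 0) :
    corr ((extensionMeasure α).map code) (rotationMeasure α t₀) ≠ 0 := by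
  have hpoly : ∀ c : ℝ, ∫ x in (0 : ℝ)..c, (2 * x - 1) = c ^ 2 - c := fun c => by
    rw [intervalIntegral.integral_sub
      ((by fun_prop : Continuous fun x : ℝ => 2 * x).intervalIntegrable 0 c)
      intervalIntegrable_const,
      intervalIntegral.integral_const_mul, integral_id]
    simp
    ring
  let Ψ : UnitAddCircle × UnitAddCircle × ℤˣ → (ℕ → ℂ) × (ℕ → ℂ) := fun p =>
    (code (itinerary α p), rotationCode α t₀ p.2.1)
  have hcm : Measurable fun p => code (itinerary α p) :=
    continuous_code.measurable.comp (measurable_itinerary α)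
  have hsm : Measurable fun p : UnitAddCircle × UnitAddCircle × ℤˣ => p.2.1 :=
    measurable_fst.comp measurable_snd
  have hrm : Measurable fun p : UnitAddCircle × UnitAddCircle × ℤˣ => rotationCode α t₀ p.2.1 :=
    (measurable_rotationCode α t₀).comp hsm
  have hΨ : Measurable Ψ := hcm.prodMk hrm
  have hfst : (extensionMeasure α).map code = skewMeasure.map fun p => code (itinerary α p) :=
    Measure.map_map continuous_code.measurable (measurable_itinerary α)
  have hs : skewMeasure.map (fun p => p.2.1) = volume := by
    have h := Measure.map_map (μ := skewMeasure) measurable_fst measurable_snd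
    have h2 : skewMeasure.map Prod.snd = volume.prod haarSign := by
      rw [skewMeasure, Measure.map_snd_prod, measure_univ, one_smul]
    rw [h2, Measure.map_fst_prod, measure_univ, one_smul] at h
    exact h.symm
  have hsnd : rotationMeasure α t₀ = skewMeasure.map fun p => rotationCode α t₀ p.2.1 := by
    rw [rotationMeasure, ← hs, Measure.map_map (measurable_rotationCode α t₀) hsm]
    rfl
  have hjoin : IsJoining (skewMeasure.map Ψ) ((extensionMeasure α).map code)
      (rotationMeasure α t₀) := by
    refine ⟨?_, ?_, (hΨ.measurePreserving skewMeasure).of_semiconj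
      (measurePreserving_skewProduct α) (fun p => ?_) (measurable_shift.prodMap measurable_shift)⟩
    · rw [hfst, Measure.map_map measurable_fst hΨ]; rfl
    · rw [hsnd, Measure.map_map measurable_snd hΨ]; rfl
    · exact Prod.ext rfl (rotationCode_add α t₀ p.2.1)
  have h0m : Measurable fun x : ℕ → ℂ => x 0 := measurable_pi_apply 0
  have hr0 : ∀ s, rotationCode α t₀ s 0 = (((cocycle t₀ s : ℤ) : ℝ) : ℂ) := fun s => by
    rw [rotationCode, zero_smul, add_zero]
    push_cast
    rfl
  have hφm : Measurable fun s => ((cocycle t₀ s : ℤ) : ℝ) :=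
    (measurable_of_countable fun u : ℤˣ => ((u : ℤ) : ℝ)).comp
      ((measurable_cocycle.comp (measurable_const.prodMk measurable_id)) :)
  have hmean : ∫ x, x 0 ∂((extensionMeasure α).map code) = 0 := by
    have h := integral_code_mul (h := fun _ => 1) measurable_const (by simp)
    rw [hfst, integral_map hcm.aemeasurable h0m.aestronglyMeasurable]
    simp_rw [code_itinerary_zero]
    rw [integral_complex_ofReal]
    simp only [mul_one] at h
    rw [h, integral_comp_rep (f := fun x => 2 * x - 1) (by fun_prop),
      ← intervalIntegral.integral_of_le zero_le_one, hpoly]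
    simp
  have hcorr : ∫ w, w.1 0 * conj (w.2 0) ∂(skewMeasure.map Ψ) =
      ((rep t₀ * (1 - rep t₀) / 2 : ℝ) : ℂ) := by
    have h := integral_code_mul (h := fun s => ((cocycle t₀ s : ℤ) : ℝ)) hφm
      fun s => (abs_sign_cast _).le
    have hm : Measurable fun w : (ℕ → ℂ) × (ℕ → ℂ) => w.1 0 * conj (w.2 0) :=
      (h0m.comp measurable_fst).mul
        (Complex.continuous_conj.measurable.comp (h0m.comp measurable_snd))
    rw [integral_map hΨ.aemeasurable hm.aestronglyMeasurable]
    simp only [Ψ, code_itinerary_zero, hr0, Complex.conj_ofReal]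
    simp_rw [← Complex.ofReal_mul]
    rw [integral_complex_ofReal, h, integral_mul_cocycle (f := fun x => 2 * x - 1) (by fun_prop)]
    rw [hpoly, hpoly]
    congr 1
    ring
  have hpos : 0 < rep t₀ * (1 - rep t₀) / 2 := by
    have h1 := rep_pos ht
    have h2 := (rep_mem t₀).2
    have : 0 < 1 - rep t₀ := by linarith
    positivity
  intro hzero
  simp only [corr, ENNReal.iSup_eq_zero] at hzero
  have h := hzero _ hjoin
  rw [hmean, zero_mul, sub_zero, hcorr, enorm_eq_zero, Complex.ofReal_eq_zero] at h
  exact hpos.ne' h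

theorem not_isConjugacyInvariant_uncorrelatedToErgodic :
    ¬ IsConjugacyInvariant UncorrelatedToErgodic := by
  intro hinv
  have hα := irrational_sqrt_two
  have ht : ((√2 : ℝ) : UnitAddCircle) ≠ 0 := by
    simpa using zsmul_coe_ne_zero hα one_ne_zero
  have hμ := isShiftMeasure_extensionMeasure √2
  have hball : ∀ z ∈ ({-1, -1 / 2, 1 / 2, 1} : Set ℂ), z ∈ Metric.closedBall (0 : ℂ) 1 := by
    intro z hz
    simp only [Set.mem_insert_iff, Set.mem_singleton_iff] at hz
    rw [mem_closedBall_zero_iff]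
    rcases hz with rfl | rfl | rfl | rfl <;> norm_num
  have h := (hinv {-1, 1} {-1, -1 / 2, 1 / 2, 1} (sequences {-1, 1}) (code '' sequences {-1, 1})
    code (extensionMeasure √2) (Set.toFinite _)
    (fun z hz => hball z (by
      simp only [Set.mem_insert_iff, Set.mem_singleton_iff] at hz ⊢
      tauto)) (Set.toFinite _) hball isSubshift_sequences_signs isSubshift_sequences_signs.code
    (isConjugacy_code isSubshift_sequences_signs) hμ hμ.supported).1
    (uncorrelatedToErgodic_extensionMeasure hα)
  exact corr_map_code_rotationMeasure_ne_zero √2 ht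
    (h _ _ isCompact_signs (isErgodicShiftMeasure_rotationMeasure hα _))

end SymbolicCorrelation

end

theorem mainTheorem11 :
    (¬ SymbolicCorrelation.IsConjugacyInvariant SymbolicCorrelation.UncorrelatedToErgodic) ∧
    (∀ X : Set (ℕ → ℂ), SymbolicCorrelation.IsSubshift {-1, 1} X →
      SymbolicCorrelation.IsSubshift {-1, -1 / 2, 1 / 2, 1} (SymbolicCorrelation.code '' X) ∧
      SymbolicCorrelation.IsConjugacy X (SymbolicCorrelation.code '' X)
        SymbolicCorrelation.code) ∧
    ∀ α : ℝ, 0 < α → α < 1 → Irrational α →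
      -- the measure on `{-1, 1}^ℕ` is uncorrelated to any ergodic measure
      SymbolicCorrelation.IsShiftMeasure {-1, 1} (SymbolicCorrelation.extensionMeasure α) ∧
      SymbolicCorrelation.UncorrelatedToErgodic (SymbolicCorrelation.extensionMeasure α) ∧
      SymbolicCorrelation.IsShiftMeasure {-1, -1 / 2, 1 / 2, 1}
        ((SymbolicCorrelation.extensionMeasure α).map SymbolicCorrelation.code) ∧
      -- the Sturmian measure is an ergodic symbolic representation of the rotation by `α`,
      -- and so is the measure obtained by coding any other proper arc `[0, t)`
      (∀ t : UnitAddCircle, t ≠ 0 →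
        (∀ s : UnitAddCircle,
          SymbolicCorrelation.rotationCode α t (s + (α : UnitAddCircle)) =
            SymbolicCorrelation.shift (SymbolicCorrelation.rotationCode α t s)) ∧
        Function.Injective (SymbolicCorrelation.rotationCode α t) ∧
        SymbolicCorrelation.IsErgodicShiftMeasure {-1, 1}
          (SymbolicCorrelation.rotationMeasure α t)) ∧
      SymbolicCorrelation.IsErgodicShiftMeasure {-1, 1}
        (SymbolicCorrelation.sturmianMeasure α) ∧
      -- the image measure is correlated to the Sturmian measure (and to the other codings)
      SymbolicCorrelation.corr
        ((SymbolicCorrelation.extensionMeasure α).map SymbolicCorrelation.code)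
        (SymbolicCorrelation.sturmianMeasure α) ≠ 0 ∧
      ∀ t : UnitAddCircle, t ≠ 0 →
        SymbolicCorrelation.corr
          ((SymbolicCorrelation.extensionMeasure α).map SymbolicCorrelation.code)
          (SymbolicCorrelation.rotationMeasure α t) ≠ 0 := by
  refine ⟨SymbolicCorrelation.not_isConjugacyInvariant_uncorrelatedToErgodic,
    fun X hX => ⟨hX.code, SymbolicCorrelation.isConjugacy_code hX⟩, fun α _ _ hα =>
    ⟨SymbolicCorrelation.isShiftMeasure_extensionMeasure α,
      SymbolicCorrelation.uncorrelatedToErgodic_extensionMeasure hα,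
      (SymbolicCorrelation.isShiftMeasure_extensionMeasure α).map_code,
      fun t ht => ⟨SymbolicCorrelation.rotationCode_add α t,
        fun s s' h => (SymbolicCorrelation.rotationCode_injective hα ht h).2,
        SymbolicCorrelation.isErgodicShiftMeasure_rotationMeasure hα t⟩,
      SymbolicCorrelation.isErgodicShiftMeasure_rotationMeasure hα _,
      SymbolicCorrelation.corr_map_code_rotationMeasure_ne_zero α ?_,
      fun t ht => SymbolicCorrelation.corr_map_code_rotationMeasure_ne_zero α ht⟩⟩
  simpa using SymbolicCorrelation.zsmul_coe_ne_zero hα one_ne_zero
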